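/- **Conventions.** Monoids are commutative and written additively. An ordered monoid is a monoid with a partial order compatible with addition; it is positively ordered if $0\le x$ for all $x$. For $x,y$ in a poset, $x\ll y$ means: for every increasing sequence $(z_n)_{n\in\mathbb N}$ that has a supremum $b\ge y$ there is $k$ with $x\le z_k$. Axioms for an ordered monoid $S$: (O1) increasing sequences have suprema; (O2) every element is the supremum of a sequence $(x_n)$ with $x_n\ll x_{n+1}$ for all $n$; (O3) $x'\ll x$ and $y'\ll y$ imply $x'+y'\ll x+y$; (O4) $\sup_n x_n+\sup_n y_n=\sup_n(x_n+y_n)$ for increasing sequences that have suprema; (PD) for every $s$ there is $p$ with $s+p\ge 0$; (PC) $t\ge 0$ and $s\le t$ imply $s+t\ge 0$; (S0) $s+t=0$ implies $s=t=0$. $\mathrm{PoS}$ is the category of posets and order-preserving maps, and $\mathrm{PoS}^*:=\mathrm{PoS}$. $\mathrm{PoM}$ is the category of positively ordered monoids with ordered monoid morphisms. $\mathrm{PoM}^*:=\mathrm{oM}^*$ is the category of ordered monoids satisfying (PC), (PD), (S0), with ordered monoid morphisms. $\mathrm{Cu}$ is the category of positively ordered monoids satisfying (O1)–(O4), and $\mathrm{Cu}^*$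 that of ordered monoids satisfying (O1)–(O4), (PC), (PD), (S0) with $0\ll 0$; in both, morphisms are the ordered monoid morphisms that preserve $\ll$ and suprema of increasing sequences. For $\mathcal C\in\{\mathrm{PoS},\mathrm{PoM},\mathrm{Cu}\}$, the objects of $\mathcal C_{*\mathrm{Gp}}$ are the pairs $(S,G)$ with $S\in\mathcal C$ and $G$ a functor from $S$ (a poset seen as a category) to abelian groups, where $G(0)$ is trivial if $\mathcal C$ is $\mathrm{PoM}$ or $\mathrm{Cu}$, and $G$ preserves inductive limits of increasing sequences (that is, $G(\sup_n s_n)=\varinjlim_n G(s_n)$) if $\mathcal C=\mathrm{Cu}$. A morphism $(S,G)\to(T,H)$ is a pair $(\alpha,\eta)$ of a $\mathcal C$-morphism $\alpha:S\to T$ and a natural transformation $\eta:G\Rightarrow H\circ\alpha$; composition is $(\beta,\nu)\circ(\alpha,\eta)=(\beta\circ\alpha,\nu_\alpha\circ\eta)$. The webbing functor $\mathfrak w:\mathcal C_{*\mathrm{Gp}}\to\mathcal C^*$ sends $(S,G)$ to $S_G=\{(s,g)\mid s\in S,\ g\in G(s)\}$, ordered by $(s,g)\le(t,h)$ iff $s\le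 t$ and $G(s\le t)(g)=h$, and (for $\mathcal C=\mathrm{PoM},\mathrm{Cu}$) with the sum $(s,g)+(t,h)=\big(s+t,\ G(s\le s+t)(g)+G(t\le s+t)(h)\big)$; it sends $(\alpha,\eta)$ to the map $(s,g)\mapsto(\alpha(s),\eta_s(g))$. **Theorem.** Let $\mathcal C$ be $\mathrm{PoS}$, $\mathrm{PoM}$ or $\mathrm{Cu}$. The webbing functor $\mathfrak w:\mathcal C_{*\mathrm{Gp}}\to\mathcal C^*$ is continuous with respect to inductive limits. That is, let $\big((S_i,G_i),(\alpha_{ij},\eta_{ij})\big)_{i\in I}$ be an inductive system in $\mathcal C_{*\mathrm{Gp}}$ indexed by a nonempty directed set $I$. Then it has an inductive limit in $\mathcal C_{*\mathrm{Gp}}$, and for every inductive limit $\big((S_\infty,G_\infty),(\alpha_{i\infty},\eta_{i\infty})\big)_i$ of it, the image of this cocone under $\mathfrak w$ is an inductive limit in $\mathcal C^*$ of the webbed system $\big(\mathfrak w(S_i,G_i),\mathfrak w(\alpha_{ij},\eta_{ij})\big)_i$. Moreover, for every inductive limit $(S,\sigma_{i\infty})_i$ of the webbed system in $\mathcal C^*$,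 the unique $\mathcal C^*$-morphism $\gamma:S\to\mathfrak w(S_\infty,G_\infty)$ with $\gamma\circ\sigma_{i\infty}=\mathfrak w(\alpha_{i\infty},\eta_{i\infty})$ for all $i$ is an order-embedding ($\gamma(x)\le\gamma(y)$ iff $x\le y$) and is surjective. -/

import Mathlib

open CategoryTheory CategoryTheory.Limits

universe u

set_option linter.unusedSectionVars false

namespace Webbing

/-! ### Order-theoretic notions -/

/-- The way-below (compact-containment) relation, defined through increasing sequences. -/
def WayBelow {S : Type u} [Preorder S] (x y : S) : Prop :=
  ∀ z : ℕ → S, Monotone z → ∀ b : S, IsLUB (Set.range z) b → y ≤ b → ∃ k, x ≤ z k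

/-- The axioms (O1)-(O4) of abstract Cuntz semigroups. -/
structure CuAxioms (S : Type u) [AddCommMonoid S] [PartialOrder S] : Prop where
  /-- (O1) every increasing sequence has a supremum. -/
  o1 : ∀ z : ℕ → S, Monotone z → ∃ b, IsLUB (Set.range z) b
  /-- (O2) every element is the supremum of a `≪`-increasing sequence. -/
  o2 : ∀ x : S, ∃ z : ℕ → S, (∀ n, WayBelow (z n) (z (n + 1))) ∧ IsLUB (Set.range z) x
  /-- (O3) addition is compatible with `≪`. -/
  o3 : ∀ x' x y' y : S, WayBelow x' x → WayBelow y' y → WayBelow (x' + y') (x + y)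
  /-- (O4) addition is compatible with suprema of increasing sequences. -/
  o4 : ∀ v w : ℕ → S, Monotone v → Monotone w → ∀ a b : S,
    IsLUB (Set.range v) a → IsLUB (Set.range w) b → IsLUB (Set.range fun n => v n + w n) (a + b)

/-- The axioms (PD), (PC) and (S0) for ordered monoids. -/
structure StarAxioms (S : Type u) [AddCommMonoid S] [PartialOrder S] : Prop where
  /-- (PD) positively directed. -/
  pd : ∀ s : S, ∃ p : S, 0 ≤ s + p
  /-- (PC) positively convex. -/
  pc : ∀ s t : S, 0 ≤ t → s ≤ t → 0 ≤ s + t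
  /-- (S0) singular at the origin. -/
  s0 : ∀ s t : S, s + t = 0 → s = 0 ∧ t = 0

/-- Ordered monoid morphisms preserving `≪` and suprema of increasing sequences. These are the
morphisms of abstract Cuntz semigroups, and of the larger category `Cu*` below. -/
structure CuHom (S T : Type u) [AddCommMonoid S] [PartialOrder S] [AddCommMonoid T]
    [PartialOrder T] extends S →+o T where
  map_wayBelow : ∀ x y : S, WayBelow x y → WayBelow (toFun x) (toFun y)
  map_isLUB : ∀ z : ℕ → S, Monotone z → ∀ b : S, IsLUB (Set.range z) b →
    IsLUB (Set.range fun n => toFun (z n)) (toFun b)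

namespace CuHom

variable {S T V : Type u} [AddCommMonoid S] [PartialOrder S] [AddCommMonoid T] [PartialOrder T]
  [AddCommMonoid V] [PartialOrder V]

instance : FunLike (CuHom S T) S T where
  coe f := f.toFun
  coe_injective f g h := by
    obtain ⟨⟨⟨⟨f, _⟩, _⟩, _⟩, _, _⟩ := f
    obtain ⟨⟨⟨⟨g, _⟩, _⟩, _⟩, _, _⟩ := g
    cases h
    rfl

/-- The identity. -/
def id (S : Type u) [AddCommMonoid S] [PartialOrder S] : CuHom S S where
  toOrderAddMonoidHom := OrderAddMonoidHom.id S
  map_wayBelow _ _ h := h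
  map_isLUB _ _ _ h := h

/-- Composition. -/
def comp (g : CuHom T V) (f : CuHom S T) : CuHom S V where
  toOrderAddMonoidHom := g.toOrderAddMonoidHom.comp f.toOrderAddMonoidHom
  map_wayBelow x y h := g.map_wayBelow _ _ (f.map_wayBelow x y h)
  map_isLUB z hz b hb := g.map_isLUB _ (fun _ _ h => f.monotone' (hz h)) _ (f.map_isLUB z hz b hb)

end CuHom

/-! ### The codomain categories `oM*` and `Cu*`

The codomain for posets is Mathlib's category `PartOrd`. -/

/-- (Commutative) ordered monoids. -/
structure OrdMon : Type (u + 1) where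
  /-- The underlying type. -/
  carrier : Type u
  [addCommMonoid : AddCommMonoid carrier]
  [partialOrder : PartialOrder carrier]
  [isOrderedAddMonoid : IsOrderedAddMonoid carrier]

namespace OrdMon

instance : CoeSort OrdMon.{u} (Type u) := ⟨OrdMon.carrier⟩

attribute [instance] addCommMonoid partialOrder isOrderedAddMonoid

/-- Morphisms of ordered monoids. -/
structure Hom (X Y : OrdMon.{u}) where
  /-- The underlying map. -/
  hom : X →+o Y

instance : Category OrdMon.{u} where
  Hom X Y := Hom X Y
  id X := ⟨OrderAddMonoidHom.id X⟩
  comp f g := ⟨g.hom.comp f.hom⟩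

instance : ConcreteCategory OrdMon.{u} (fun X Y => X →+o Y) where
  hom f := f.hom
  ofHom f := ⟨f⟩

end OrdMon

/-- The ordered monoids that satisfy (PC), (PD) and (S0). -/
def isStar : ObjectProperty OrdMon.{u} := fun X => StarAxioms X

/-- The category `oM*`, a full subcategory of the category of ordered monoids. -/
abbrev OMStar : Type (u + 1) := isStar.{u}.FullSubcategory

/-- The objects of `Cu*`: ordered monoids with compact neutral element that satisfy (O1)-(O4),
(PC), (PD) and (S0). -/
structure CuStar : Type (u + 1) where
  /-- The underlying ordered monoid. -/
  toOrdMon : OrdMon.{u}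
  zero_compact : WayBelow (0 : toOrdMon) 0
  cuAxioms : CuAxioms toOrdMon
  starAxioms : StarAxioms toOrdMon

namespace CuStar

instance : CoeSort CuStar.{u} (Type u) := ⟨fun X => X.toOrdMon⟩

/-- Morphisms of `Cu*`. -/
structure Hom (X Y : CuStar.{u}) where
  /-- The underlying map. -/
  hom : CuHom X Y

instance : Category CuStar.{u} where
  Hom X Y := Hom X Y
  id X := ⟨CuHom.id X⟩
  comp f g := ⟨g.hom.comp f.hom⟩

instance : ConcreteCategory CuStar.{u} (fun X Y => CuHom X Y) where
  hom f := f.hom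
  ofHom f := ⟨f⟩

end CuStar

/-! ### The webbed poset `S_G` -/

section Transport

variable {S : Type u} [Preorder S] (G : S ⥤ AddCommGrpCat.{u})

/-- The group morphism `G(s ≤ t)`. -/
def tr {s t : S} (h : s ≤ t) : G.obj s →+ G.obj t := (G.map (homOfLE h)).hom

theorem tr_refl {s : S} (h : s ≤ s) (g : G.obj s) : tr G h g = g := by
  exact congrArg (fun f => f.hom g) (G.map_id s)

theorem tr_tr {s t v : S} (h : s ≤ t) (h' : t ≤ v) (g : G.obj s) :
    tr G h' (tr G h g) = tr G (h.trans h') g := by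
  exact congrArg (fun f => f.hom g) (G.map_comp (homOfLE h) (homOfLE h')).symm

theorem tr_congr {s s' t : S} (e : s = s') (h : s ≤ t) (h' : s' ≤ t) (g : G.obj s)
    (g' : G.obj s') (hg : tr G e.le g = g') : tr G h g = tr G h' g' := by
  rw [← hg, tr_tr]

theorem app_tr {T : Type u} [Preorder T] {H : T ⥤ AddCommGrpCat.{u}} {G : S ⥤ AddCommGrpCat.{u}}
    {α : S → T} {hα : Monotone α} (η : G ⟶ hα.functor ⋙ H) {s t : S} (h : s ≤ t) (g : G.obj s) :
    (η.app t).hom (tr G h g) = tr H (hα h) ((η.app s).hom g) :=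
  congrArg (fun f => f.hom g) (η.naturality (homOfLE h))

end Transport

/-- The set `S_G` of the pairs `(s, g)` with `s ∈ S` and `g ∈ G(s)`. -/
structure Web {S : Type u} [Preorder S] (G : S ⥤ AddCommGrpCat.{u}) : Type u where
  /-- The element of the base space. -/
  base : S
  /-- The element of the fiber. -/
  val : G.obj base

namespace Web

section Order

variable {S : Type u} [PartialOrder S] {G : S ⥤ AddCommGrpCat.{u}}

theorem ext' {x y : Web G} (h : x.base = y.base) (h' : tr G h.le x.val = y.val) : x = y := by
  obtain ⟨s, g⟩ := x
  obtain ⟨t, k⟩ := y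
  obtain rfl : s = t := h
  obtain rfl : g = k := by simpa [tr_refl] using h'
  rfl

/-- `(s, g) ≤ (t, h)` when `s ≤ t` and `G(s ≤ t)(g) = h`. -/
instance : PartialOrder (Web G) where
  le x y := ∃ h : x.base ≤ y.base, tr G h x.val = y.val
  le_refl x := ⟨le_rfl, tr_refl G _ _⟩
  le_trans x y z := by
    rintro ⟨h, h'⟩ ⟨k, k'⟩
    exact ⟨h.trans k, by rw [← k', ← h', tr_tr]⟩
  le_antisymm x y := by
    rintro ⟨h, h'⟩ ⟨k, k'⟩
    exact ext' (le_antisymm h k) h'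

theorem le_def {x y : Web G} : x ≤ y ↔ ∃ h : x.base ≤ y.base, tr G h x.val = y.val := Iff.rfl

/-- The map `α_η : S_G → T_H`, `(s, g) ↦ (α(s), η_s(g))`. -/
def map {T : Type u} [PartialOrder T] {H : T ⥤ AddCommGrpCat.{u}} {α : S → T} {hα : Monotone α}
    (η : G ⟶ hα.functor ⋙ H) (x : Web G) : Web H :=
  ⟨α x.base, (η.app x.base).hom x.val⟩

theorem map_mono {T : Type u} [PartialOrder T] {H : T ⥤ AddCommGrpCat.{u}} {α : S → T}
    {hα : Monotone α} (η : G ⟶ hα.functor ⋙ H) : Monotone (map η) := by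
  rintro x y ⟨h, h'⟩
  refine ⟨hα h, ?_⟩
  have := app_tr η h x.val
  rw [h'] at this
  exact this.symm

end Order

section Monoid

variable {S : Type u} [AddCommMonoid S] [PartialOrder S] [IsOrderedAddMonoid S]
  [IsBotZeroClass S] {G : S ⥤ AddCommGrpCat.{u}}

theorem le_left (s t : S) : s ≤ s + t := le_add_of_nonneg_right (IsBotZeroClass.isBot_zero t)

theorem le_right (s t : S) : t ≤ s + t := le_add_of_nonneg_left (IsBotZeroClass.isBot_zero s)

/-- `(s, g) + (t, h) = (s + t, G(s ≤ s + t)(g) + G(t ≤ s + t)(h))`. -/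
instance : Add (Web G) :=
  ⟨fun x y => ⟨x.base + y.base,
    tr G (le_left x.base y.base) x.val + tr G (le_right x.base y.base) y.val⟩⟩

/-- The neutral element `(0, e)`. -/
instance : Zero (Web G) := ⟨⟨0, 0⟩⟩

theorem add_base (x y : Web G) : (x + y).base = x.base + y.base := rfl

theorem add_val (x y : Web G) : (x + y).val =
    tr G (le_left x.base y.base) x.val + tr G (le_right x.base y.base) y.val := rfl

theorem zero_val : (0 : Web G).val = 0 := rfl

theorem tr_add_val (x y : Web G) {t : S} (h : (x + y).base ≤ t) : tr G h (x + y).val =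
    tr G ((le_left x.base y.base).trans h) x.val
      + tr G ((le_right x.base y.base).trans h) y.val := by
  rw [add_val, map_add]
  exact congrArg₂ _ (tr_tr G _ _ _) (tr_tr G _ _ _)

theorem tr_zero_val {t : S} (h : (0 : Web G).base ≤ t) : tr G h (0 : Web G).val = 0 := by
  rw [zero_val]
  exact map_zero _

instance : AddCommMonoid (Web G) where
  add_assoc x y z := by
    refine ext' (add_assoc _ _ _) ?_
    rw [tr_add_val, tr_add_val, add_val x (y + z), tr_add_val y z, add_assoc]
  zero_add x := by
    refine ext' (zero_add _) ?_
    rw [tr_add_val, tr_zero_val, zero_add, tr_refl]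
  add_zero x := by
    refine ext' (add_zero _) ?_
    rw [tr_add_val, tr_zero_val, add_zero, tr_refl]
  add_comm x y := by
    refine ext' (add_comm _ _) ?_
    rw [tr_add_val, add_val y x, add_comm]
  nsmul := nsmulRec

theorem add_le_add' {x x' y y' : Web G} (h : x ≤ x') (h' : y ≤ y') : x + y ≤ x' + y' := by
  obtain ⟨h, k⟩ := h
  obtain ⟨h', k'⟩ := h'
  refine ⟨add_le_add h h', ?_⟩
  rw [tr_add_val, add_val, ← k, ← k', tr_tr, tr_tr]

instance : IsOrderedAddMonoid (Web G) where
  add_le_add_left _ _ h _ := add_le_add' h le_rfl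

theorem zero_le_iff {x : Web G} : 0 ≤ x ↔ x.val = 0 := by
  constructor
  · rintro ⟨h, k⟩
    rw [← k, tr_zero_val]
  · intro h
    exact ⟨IsBotZeroClass.isBot_zero _, by rw [tr_zero_val, h]⟩

theorem starAxioms (h0 : Subsingleton (G.obj 0)) : StarAxioms (Web G) where
  pd x := ⟨⟨x.base, -x.val⟩, by rw [zero_le_iff, add_val, map_neg, add_neg_cancel]⟩
  pc x y hy hxy := by
    obtain ⟨h, k⟩ := hxy
    rw [zero_le_iff] at hy ⊢
    have : tr G (le_left x.base y.base) x.val = tr G (le_right x.base y.base) y.val := by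
      rw [← k, tr_tr]
    rw [add_val, this, hy, map_zero, add_zero]
  s0 x y h := by
    have hb : x.base + y.base = 0 := congrArg Web.base h
    have hx : x.base = 0 :=
      le_antisymm (hb ▸ le_left _ _) (IsBotZeroClass.isBot_zero _)
    have hy : y.base = 0 :=
      le_antisymm (hb ▸ le_right _ _) (IsBotZeroClass.isBot_zero _)
    exact ⟨ext' hx (h0.elim _ _), ext' hy (h0.elim _ _)⟩

variable {T : Type u} [AddCommMonoid T] [PartialOrder T] [IsOrderedAddMonoid T]
  [IsBotZeroClass T] {H : T ⥤ AddCommGrpCat.{u}}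

/-- The map `α_η` as a morphism of ordered monoids. -/
def mapHom (α : S →+o T) (η : G ⟶ α.monotone'.functor ⋙ H) : Web G →+o Web H where
  toFun := map η
  monotone' := map_mono η
  map_zero' := by
    refine ext' (map_zero α) ?_
    rw [zero_val]
    exact (congrArg _ (map_zero (η.app 0).hom)).trans (map_zero _)
  map_add' x y := by
    refine ext' (map_add α _ _) ?_
    rw [add_val (map η x)]
    have h1 := app_tr η (le_left x.base y.base) x.val
    have h2 := app_tr η (le_right x.base y.base) y.val
    have h3 : (map η (x + y)).val = (η.app (x.base + y.base)).hom
        (tr G (le_left x.base y.base) x.val + tr G (le_right x.base y.base) y.val) := rfl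
    have h4 : (map η (x + y)).val = tr H (α.monotone' (le_left x.base y.base)) (map η x).val
        + tr H (α.monotone' (le_right x.base y.base)) (map η y).val := by
      rw [h3, map_add, h1, h2]
      rfl
    rw [h4]
    exact (map_add _ _ _).trans (congrArg₂ _ (tr_tr H _ _ _) (tr_tr H _ _ _))

end Monoid

section Cuntz

variable {S : Type u} [PartialOrder S] {G : S ⥤ AddCommGrpCat.{u}}

/-- If `G` is continuous and `b = sup z_n`, then every element of `G(b)` comes from some `G(z_n)`. -/
theorem exists_tr_eq [PreservesColimitsOfShape ℕ G] {z : ℕ → S} (hz : Monotone z) {b : S}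
    (hb : IsLUB (Set.range z) b) (g : G.obj b) :
    ∃ n, ∃ k : G.obj (z n), tr G (hb.1 ⟨n, rfl⟩) k = g := by
  have := preservesSmallestFilteredColimits_of_preservesFilteredColimits
    (forget AddCommGrpCat.{u})
  have hc := isColimitOfPreserves G
    (Preorder.colimitCoconeOfIsLUB hz.functor (pt := b) hb).isColimit
  obtain ⟨n, k, hk⟩ := Concrete.isColimit_exists_rep _ hc g
  exact ⟨n, k, hk⟩

/-- If `G` is continuous and `b = sup z_n`, then elements of `G(z_n)` with the same image in `G(b)`
agree eventually. -/
theorem tr_eq_of_tr_eq [PreservesColimitsOfShape ℕ G] {z : ℕ → S} (hz : Monotone z) {b : S}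
    (hb : IsLUB (Set.range z) b) {n : ℕ} (g k : G.obj (z n))
    (h : tr G (hb.1 ⟨n, rfl⟩) g = tr G (hb.1 ⟨n, rfl⟩) k) :
    ∃ m, ∃ hm : n ≤ m, tr G (hz hm) g = tr G (hz hm) k := by
  have := preservesSmallestFilteredColimits_of_preservesFilteredColimits
    (forget AddCommGrpCat.{u})
  have hc := isColimitOfPreserves G
    (Preorder.colimitCoconeOfIsLUB hz.functor (pt := b) hb).isColimit
  obtain ⟨m, f, f', hm⟩ := Concrete.isColimit_exists_of_rep_eq.{u} _ hc g k h
  exact ⟨m, leOfHom f, hm⟩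

/-- If `(z_n)` increases in `S_G` and its base points have supremum `b`, then `(z_n)` has a
supremum over `b`, and it is the only upper bound over `b`. -/
theorem isLUB_of_base {z : ℕ → Web G} (hz : Monotone z) {x : Web G}
    (hb : IsLUB (Set.range fun n => (z n).base) x.base) (h0 : z 0 ≤ x) :
    IsLUB (Set.range z) x := by
  have hx : ∀ n, z n ≤ x := by
    intro n
    obtain ⟨h, k⟩ := h0
    obtain ⟨h', k'⟩ := hz (Nat.zero_le n)
    exact ⟨hb.1 ⟨n, rfl⟩, by rw [← k, ← k', tr_tr]⟩
  refine ⟨by rintro _ ⟨n, rfl⟩; exact hx n, ?_⟩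
  intro y hy
  have hbase : x.base ≤ y.base := hb.2 (by
    rintro _ ⟨n, rfl⟩
    exact (hy ⟨n, rfl⟩).1)
  refine ⟨hbase, ?_⟩
  obtain ⟨h, k⟩ := h0
  obtain ⟨h', k'⟩ := hy ⟨0, rfl⟩
  rw [← k, ← k', tr_tr]

theorem base_mono {z : ℕ → Web G} (hz : Monotone z) : Monotone fun n => (z n).base :=
  fun _ _ h => (hz h).1

/-- Suprema of increasing sequences in `S_G` lie over suprema in `S`. -/
theorem base_isLUB {z : ℕ → Web G} (hz : Monotone z) {x : Web G} (h : IsLUB (Set.range z) x) :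
    IsLUB (Set.range fun n => (z n).base) x.base := by
  refine ⟨by rintro _ ⟨n, rfl⟩; exact (h.1 ⟨n, rfl⟩).1, ?_⟩
  intro y hy
  have h0 : (z 0).base ≤ y := hy ⟨0, rfl⟩
  refine (h.2 (?_ : (⟨y, tr G h0 (z 0).val⟩ : Web G) ∈ _)).1
  rintro _ ⟨n, rfl⟩
  obtain ⟨k, k'⟩ := hz (Nat.zero_le n)
  exact ⟨hy ⟨n, rfl⟩, by rw [← k', tr_tr]⟩

/-- A sequence in the base that increases to `x.base` lifts, after a shift, to one that increases
to `x`. -/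
theorem exists_lift [PreservesColimitsOfShape ℕ G] (x : Web G) {z : ℕ → S} (hz : Monotone z)
    (hb : IsLUB (Set.range z) x.base) : ∃ m, ∃ w : ℕ → Web G, Monotone w ∧
      (∀ n, (w n).base = z (m + n)) ∧ IsLUB (Set.range w) x := by
  obtain ⟨m, k, hk⟩ := exists_tr_eq hz hb x.val
  let w : ℕ → Web G := fun n => ⟨z (m + n), tr G (hz (Nat.le_add_right m n)) k⟩
  have hw : Monotone w := fun i j h =>
    ⟨hz (Nat.add_le_add_left h m), tr_tr G _ _ _⟩
  refine ⟨m, w, hw, fun _ => rfl, isLUB_of_base hw ?_ ⟨hb.1 ⟨m, rfl⟩, ?_⟩⟩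
  · refine ⟨by rintro _ ⟨n, rfl⟩; exact hb.1 ⟨m + n, rfl⟩, fun y hy => hb.2 ?_⟩
    rintro _ ⟨n, rfl⟩
    exact (hz (Nat.le_add_left n m)).trans (hy ⟨n, rfl⟩)
  · exact (tr_tr G _ _ _).trans hk

theorem wayBelow_le {T : Type u} [PartialOrder T] {s t : T} (h : WayBelow s t) : s ≤ t := by
  obtain ⟨_, h⟩ := h (fun _ => t) (fun _ _ _ => le_rfl) t (by simp) le_rfl
  exact h

theorem wayBelow_iff [PreservesColimitsOfShape ℕ G] {x y : Web G} :
    WayBelow x y ↔ WayBelow x.base y.base ∧ x ≤ y := by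
  constructor
  · intro h
    refine ⟨?_, wayBelow_le h⟩
    intro z hz b hb hyb
    obtain ⟨m, w, hw, hwz, hwb⟩ := exists_lift (⟨b, tr G hyb y.val⟩ : Web G) hz hb
    obtain ⟨n, hn⟩ := h w hw _ hwb ⟨hyb, rfl⟩
    exact ⟨m + n, hwz n ▸ hn.1⟩
  · rintro ⟨h, hxy⟩ z hz b hb hyb
    obtain ⟨n, hn⟩ := h _ (base_mono hz) _ (base_isLUB hz hb) hyb.1
    have hlub := base_isLUB hz hb
    have e : tr G (hlub.1 ⟨n, rfl⟩) (tr G hn x.val) = tr G (hlub.1 ⟨n, rfl⟩) (z n).val := by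
      obtain ⟨p, p'⟩ := hxy.trans hyb
      obtain ⟨q, q'⟩ := hb.1 ⟨n, rfl⟩
      rw [tr_tr, q', p']
    obtain ⟨m, hm, e'⟩ := tr_eq_of_tr_eq (base_mono hz) hlub _ _ e
    refine ⟨m, hn.trans (hz hm).1, ?_⟩
    rw [← tr_tr G hn (hz hm).1, e']
    exact (hz hm).2

end Cuntz

section CuntzMonoid

variable {S : Type u} [AddCommMonoid S] [PartialOrder S] [IsOrderedAddMonoid S]
  [IsBotZeroClass S] {G : S ⥤ AddCommGrpCat.{u}} [PreservesColimitsOfShape ℕ G]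

theorem zero_compact : WayBelow (0 : Web G) 0 :=
  wayBelow_iff.2 ⟨fun _ _ _ _ _ => ⟨0, IsBotZeroClass.isBot_zero _⟩, le_rfl⟩

theorem cuAxioms (hS : CuAxioms S) : CuAxioms (Web G) where
  o1 z hz := by
    obtain ⟨b, hb⟩ := hS.o1 _ (base_mono hz)
    exact ⟨⟨b, tr G (hb.1 ⟨0, rfl⟩) (z 0).val⟩, isLUB_of_base hz hb ⟨hb.1 ⟨0, rfl⟩, rfl⟩⟩
  o2 x := by
    obtain ⟨z, hz, hb⟩ := hS.o2 x.base
    obtain ⟨m, w, hw, hwz, hwb⟩ :=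
      exists_lift x (monotone_nat_of_le_succ fun n => wayBelow_le (hz n)) hb
    refine ⟨w, fun n => wayBelow_iff.2 ⟨?_, hw (Nat.le_succ n)⟩, hwb⟩
    rw [hwz, hwz]
    exact hz (m + n)
  o3 x' x y' y hx hy := by
    rw [wayBelow_iff] at hx hy ⊢
    exact ⟨hS.o3 _ _ _ _ hx.1 hy.1, add_le_add' hx.2 hy.2⟩
  o4 v w hv hw a b ha hb :=
    isLUB_of_base (fun _ _ h => add_le_add' (hv h) (hw h))
      (hS.o4 _ _ (base_mono hv) (base_mono hw) _ _ (base_isLUB hv ha) (base_isLUB hw hb))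
      (add_le_add' (ha.1 ⟨0, rfl⟩) (hb.1 ⟨0, rfl⟩))

variable {T : Type u} [AddCommMonoid T] [PartialOrder T] [IsOrderedAddMonoid T]
  [IsBotZeroClass T] {H : T ⥤ AddCommGrpCat.{u}} [PreservesColimitsOfShape ℕ H]

/-- The map `α_η` as a morphism of `Cu*`. -/
def mapCuHom (α : CuHom S T) (η : G ⟶ α.monotone'.functor ⋙ H) : CuHom (Web G) (Web H) where
  toOrderAddMonoidHom := mapHom α.toOrderAddMonoidHom η
  map_wayBelow x y h := by
    rw [wayBelow_iff] at h
    exact wayBelow_iff.2 ⟨α.map_wayBelow _ _ h.1, map_mono η h.2⟩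
  map_isLUB z hz b hb :=
    isLUB_of_base (fun _ _ h => map_mono η (hz h))
      (α.map_isLUB _ (base_mono hz) _ (base_isLUB hz hb)) (map_mono η (hb.1 ⟨0, rfl⟩))

end CuntzMonoid

end Web

/-! ### The categories of group systems -/

section Nat

variable {S T V : Type u} [Preorder S] [Preorder T] [Preorder V]

/-- The identity transformation `G ⇒ G ∘ id`. -/
def natId (G : S ⥤ AddCommGrpCat.{u}) (h : Monotone fun s : S => s) : G ⟶ h.functor ⋙ G where
  app s := 𝟙 (G.obj s)
  naturality _ _ f := (Category.comp_id (G.map f)).trans (Category.id_comp (G.map f)).symm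

/-- For `η : G ⇒ H ∘ α` and `ν : H ⇒ J ∘ β`, the composite `ν_α ∘ η : G ⇒ J ∘ (β ∘ α)`. -/
def natComp {G : S ⥤ AddCommGrpCat.{u}} {H : T ⥤ AddCommGrpCat.{u}} {J : V ⥤ AddCommGrpCat.{u}}
    {α : S → T} {hα : Monotone α} {β : T → V} {hβ : Monotone β} (η : G ⟶ hα.functor ⋙ H)
    (ν : H ⟶ hβ.functor ⋙ J) (h : Monotone fun s => β (α s)) : G ⟶ h.functor ⋙ J where
  app s := η.app s ≫ ν.app (α s)
  naturality _ _ f := (η ≫ Functor.whiskerLeft hα.functor ν).naturality f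

end Nat

/-- Partially ordered group systems `(S, G)`. -/
structure PoSGp : Type (u + 1) where
  /-- The base space `S`. -/
  base : PartOrd.{u}
  /-- The functor `G`. -/
  fib : base ⥤ AddCommGrpCat.{u}

namespace PoSGp

/-- Morphisms `(α, η)` of partially ordered group systems. -/
structure Hom (X Y : PoSGp.{u}) where
  /-- The order-preserving map `α`. -/
  base : X.base →o Y.base
  /-- The natural transformation `η : G ⇒ H ∘ α`. -/
  fib : X.fib ⟶ base.monotone.functor ⋙ Y.fib

theorem Hom.ext' {X Y : PoSGp.{u}} {f g : Hom X Y} (h : f.base = g.base)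
    (h' : ∀ s, HEq (f.fib.app s) (g.fib.app s)) : f = g := by
  obtain ⟨α, η⟩ := f
  obtain ⟨β, ν⟩ := g
  obtain rfl : α = β := h
  obtain rfl : η = ν := NatTrans.ext (funext fun s => eq_of_heq (h' s))
  rfl

instance : Category PoSGp.{u} where
  Hom X Y := Hom X Y
  id X := ⟨OrderHom.id, natId X.fib _⟩
  comp f g := ⟨g.base.comp f.base, natComp f.fib g.fib _⟩
  id_comp _ := Hom.ext' rfl fun _ => heq_of_eq (Category.id_comp _)
  comp_id _ := Hom.ext' rfl fun _ => heq_of_eq (Category.comp_id _)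
  assoc _ _ _ := Hom.ext' rfl fun _ => heq_of_eq (Category.assoc _ _ _)

end PoSGp

/-- The webbing functor `PoS_{*Gp} ⥤ PoS`. -/
def webPoS : PoSGp.{u} ⥤ PartOrd.{u} where
  obj X := PartOrd.of (Web X.fib)
  map f := PartOrd.ofHom ⟨Web.map f.fib, Web.map_mono f.fib⟩
  map_id _ := rfl
  map_comp _ _ := rfl

/-- Pomonoid group systems `(S, G)`: here `S` is a positively ordered monoid and `G(0)` is
trivial. -/
structure PoMGp : Type (u + 1) where
  /-- The base space `S`. -/
  base : OrdMon.{u}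
  [isBotZero : IsBotZeroClass base]
  /-- The functor `G`. -/
  fib : base ⥤ AddCommGrpCat.{u}
  subsingleton_zero : Subsingleton (fib.obj 0)

namespace PoMGp

attribute [instance] isBotZero

/-- Morphisms `(α, η)` of pomonoid group systems. -/
structure Hom (X Y : PoMGp.{u}) where
  /-- The morphism `α` of ordered monoids. -/
  base : X.base →+o Y.base
  /-- The natural transformation `η : G ⇒ H ∘ α`. -/
  fib : X.fib ⟶ base.monotone'.functor ⋙ Y.fib

theorem Hom.ext' {X Y : PoMGp.{u}} {f g : Hom X Y} (h : f.base = g.base)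
    (h' : ∀ s, HEq (f.fib.app s) (g.fib.app s)) : f = g := by
  obtain ⟨α, η⟩ := f
  obtain ⟨β, ν⟩ := g
  obtain rfl : α = β := h
  obtain rfl : η = ν := NatTrans.ext (funext fun s => eq_of_heq (h' s))
  rfl

instance : Category PoMGp.{u} where
  Hom X Y := Hom X Y
  id X := ⟨OrderAddMonoidHom.id X.base, natId X.fib _⟩
  comp f g := ⟨g.base.comp f.base, natComp f.fib g.fib _⟩
  id_comp _ := Hom.ext' rfl fun _ => heq_of_eq (Category.id_comp _)
  comp_id _ := Hom.ext' rfl fun _ => heq_of_eq (Category.comp_id _)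
  assoc _ _ _ := Hom.ext' rfl fun _ => heq_of_eq (Category.assoc _ _ _)

end PoMGp

/-- The webbing functor `PoM_{*Gp} ⥤ oM*`. -/
def webPoM : PoMGp.{u} ⥤ OMStar.{u} where
  obj X := ⟨⟨Web X.fib⟩, Web.starAxioms X.subsingleton_zero⟩
  map f := ObjectProperty.homMk ⟨Web.mapHom f.base f.fib⟩
  map_id _ := rfl
  map_comp _ _ := rfl

/-- Cuntz group systems `(S, G)`: here `S` is an abstract Cuntz semigroup (a positively ordered
monoid with (O1)-(O4)), the functor `G` sends suprema of increasing sequences in `S` to inductive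
limits of groups, and `G(0)` is trivial. -/
structure CuGp : Type (u + 1) where
  /-- The base space `S`. -/
  base : OrdMon.{u}
  [isBotZero : IsBotZeroClass base]
  cuAxioms : CuAxioms base
  /-- The functor `G`. -/
  fib : base ⥤ AddCommGrpCat.{u}
  [preserves : PreservesColimitsOfShape ℕ fib]
  subsingleton_zero : Subsingleton (fib.obj 0)

namespace CuGp

attribute [instance] isBotZero preserves

/-- Morphisms `(α, η)` of Cuntz group systems. -/
structure Hom (X Y : CuGp.{u}) where
  /-- The morphism `α` of Cuntz semigroups. -/
  base : CuHom X.base Y.base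
  /-- The natural transformation `η : G ⇒ H ∘ α`. -/
  fib : X.fib ⟶ base.monotone'.functor ⋙ Y.fib

theorem Hom.ext' {X Y : CuGp.{u}} {f g : Hom X Y} (h : f.base = g.base)
    (h' : ∀ s, HEq (f.fib.app s) (g.fib.app s)) : f = g := by
  obtain ⟨α, η⟩ := f
  obtain ⟨β, ν⟩ := g
  obtain rfl : α = β := h
  obtain rfl : η = ν := NatTrans.ext (funext fun s => eq_of_heq (h' s))
  rfl

instance : Category CuGp.{u} where
  Hom X Y := Hom X Y
  id X := ⟨CuHom.id X.base, natId X.fib _⟩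
  comp f g := ⟨g.base.comp f.base, natComp f.fib g.fib _⟩
  id_comp _ := Hom.ext' rfl fun _ => heq_of_eq (Category.id_comp _)
  comp_id _ := Hom.ext' rfl fun _ => heq_of_eq (Category.comp_id _)
  assoc _ _ _ := Hom.ext' rfl fun _ => heq_of_eq (Category.assoc _ _ _)

end CuGp

/-- The webbing functor `Cu_{*Gp} ⥤ Cu*`. -/
def webCu : CuGp.{u} ⥤ CuStar.{u} where
  obj X := ⟨⟨Web X.fib⟩, Web.zero_compact, Web.cuAxioms X.cuAxioms,
    Web.starAxioms X.subsingleton_zero⟩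
  map f := ⟨Web.mapCuHom f.base f.fib⟩
  map_id _ := rfl
  map_comp _ _ := rfl

end Webbing

/-!
Inductive limits along a directed set are preserved by the webbing functors.

It is enough to produce, for every system, one colimit whose web is again a colimit
(`exists_colimit_and_isIso`): the remaining assertions are formal, because the comparison morphism
between two colimits is an isomorphism, and an isomorphism is a surjective order-embedding.

Colimits are recognised by elementwise criteria that make no reference to positivity, so that the
same criterion serves for the base spaces and for their webs. For posets and ordered monoids a
compatible family is a colimit when it is jointly surjective and every inequality in the limit
holds at some stage (`IsDirectLimit`). For abstract Cuntz semigroups, the images of the stages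
need only be dense for `≪`, and an inequality has to hold at some stage only after its left-hand
side is replaced by an element way below it (`IsCuLimit`); the universal property
`IsCuLimit.exists_desc` follows by sending `s` to the supremum of the images of the pairs `(i, a)`
that approximate `s` (`Approx`), which are directed with a countable cofinal subset. The colimit
of the base spaces itself is the quotient of their disjoint union, and in the Cuntz case the
completion of this quotient by countably generated round ideals (`exists_isCuLimit`).

Over the colimit `S` of the base spaces, the group over `s` is the filtered colimit of the groups
`G_i(a)` over the pairs `(i, a)` that approximate `s`: those with `α_i(a) ≤ s` for posets and
monoids, those that satisfy `Approx` for Cuntz semigroups. The structure `GermFrame` isolates what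
the two cases share. Every element of the web of this limit functor is then a germ, that is, the
class of an element of the web of some stage. Since an element of a web has exactly one element
above it over each larger base point, an inequality between germs amounts to one between base
points together with an equality of germs, which holds at some stage. Hence the criterion for the
base spaces carries over to the webs (`IsDirectLimit.isDirectLimit_webOf`,
`IsCuLimit.isCuLimit_cuWebOf`).
-/

namespace Webbing

/-! ### Directed systems of posets and their colimits -/

section Systems

variable {J : Type u} [Preorder J] {S : J → Type u} [∀ i, PartialOrder (S i)]

/-- A system of posets and order-preserving maps indexed by `J`. The transition maps are plain
functions, so that the notion applies at once to posets, ordered monoids and Cuntz semigroups. -/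
structure IsSystem (f : ∀ ⦃i j : J⦄, i ≤ j → S i → S j) : Prop where
  mono : ∀ ⦃i j⦄ (h : i ≤ j), Monotone (f h)
  id : ∀ i (a : S i), f le_rfl a = a
  comp : ∀ ⦃i j k⦄ (h : i ≤ j) (h' : j ≤ k) (a : S i), f h' (f h a) = f (h.trans h') a

/-- A compatible family of order-preserving maps out of a system. -/
structure IsCompatible (f : ∀ ⦃i j : J⦄, i ≤ j → S i → S j) {T : Type u} [PartialOrder T]
    (τ : ∀ i, S i → T) : Prop where
  mono : ∀ i, Monotone (τ i)
  comp : ∀ ⦃i j⦄ (h : i ≤ j) (a : S i), τ j (f h a) = τ i a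

/-- The compatible family `α` exhibits `A` as the algebraic direct limit of the system: it is
jointly surjective, and an inequality in `A` holds at some stage already. -/
structure IsDirectLimit (f : ∀ ⦃i j : J⦄, i ≤ j → S i → S j) {A : Type u} [PartialOrder A]
    (α : ∀ i, S i → A) : Prop extends IsCompatible f α where
  surj : ∀ s, ∃ i a, α i a = s
  le_of_le : ∀ ⦃i j⦄ (a : S i) (b : S j), α i a ≤ α j b →
    ∃ k, ∃ (hi : i ≤ k) (hj : j ≤ k), f hi a ≤ f hj b

variable {f : ∀ ⦃i j : J⦄, i ≤ j → S i → S j} {A T : Type u} [PartialOrder A] [PartialOrder T]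
  {α : ∀ i, S i → A} {τ : ∀ i, S i → T}

theorem IsCompatible.le_of_le (hτ : IsCompatible f τ) {i j k : J} {a : S i} {b : S j}
    (hi : i ≤ k) (hj : j ≤ k) (h : f hi a ≤ f hj b) : τ i a ≤ τ j b := by
  rw [← hτ.comp hi, ← hτ.comp hj]
  exact hτ.mono k h

namespace IsDirectLimit

theorem exists_desc (hα : IsDirectLimit f α) (hτ : IsCompatible f τ) :
    ∃ γ : A → T, Monotone γ ∧ ∀ i a, γ (α i a) = τ i a := by
  choose r a hr using hα.surj
  have key : ∀ {i j} (x : S i) (y : S j), α i x ≤ α j y → τ i x ≤ τ j y := by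
    intro i j x y h
    obtain ⟨k, hi, hj, h⟩ := hα.le_of_le x y h
    exact hτ.le_of_le hi hj h
  refine ⟨fun s => τ (r s) (a s), fun s t h => key _ _ (by rwa [hr, hr]), fun i x => ?_⟩
  exact le_antisymm (key _ _ (hr _).le) (key _ _ (hr _).ge)

/-- Two elements of a directed limit come from a common stage. -/
theorem surj₂ [IsDirectedOrder J] (hα : IsDirectLimit f α) (s t : A) :
    ∃ i a b, α i a = s ∧ α i b = t := by
  obtain ⟨i, a, rfl⟩ := hα.surj s
  obtain ⟨j, b, rfl⟩ := hα.surj t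
  obtain ⟨k, hi, hj⟩ := exists_ge_ge i j
  exact ⟨k, f hi a, f hj b, hα.comp _ _, hα.comp _ _⟩

end IsDirectLimit

end Systems

/-- The universal property of the direct limit among ordered monoids. -/
theorem IsDirectLimit.exists_addDesc {J : Type u} [Preorder J] [IsDirectedOrder J] [Nonempty J]
    {S : J → Type u} [∀ i, PartialOrder (S i)] [∀ i, AddCommMonoid (S i)]
    {f : ∀ ⦃i j : J⦄, i ≤ j → S i →+o S j} {A T : Type u} [PartialOrder A] [AddCommMonoid A]
    [PartialOrder T] [AddCommMonoid T] {α : ∀ i, S i →+o A} {τ : ∀ i, S i →+o T}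
    (hα : IsDirectLimit (fun _ _ h => f h) fun i => α i)
    (hτ : IsCompatible (fun _ _ h => f h) fun i => τ i) :
    ∃ γ : A →+o T, ∀ i a, γ (α i a) = τ i a := by
  obtain ⟨γ, hγ, h⟩ := hα.exists_desc hτ
  refine ⟨{ toFun := γ, monotone' := hγ, map_zero' := ?_, map_add' := fun s t => ?_ }, h⟩
  · obtain ⟨i⟩ := ‹Nonempty J›
    have := h i 0
    rwa [map_zero, map_zero] at this
  · obtain ⟨i, a, b, rfl, rfl⟩ := hα.surj₂ s t
    have := h i (a + b)
    rw [map_add, map_add] at this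
    change γ _ = γ _ + γ _
    rw [this, h, h]

/-! ### Existence of direct limits of posets and ordered monoids -/

section OrderedLimit

variable {J : Type u} [Preorder J] [IsDirectedOrder J] {S : J → Type u} [∀ i, PartialOrder (S i)]
  {T : ∀ ⦃i j : J⦄, i ≤ j → Type u} {f : ∀ _ _ h, T h}
  [∀ i j (h : i ≤ j), FunLike (T h) (S i) (S j)]
  [DirectedSystem S (f · · ·)]

variable (f) in
/-- The direct limit of a system of posets. This is a type synonym of `DirectLimit S f`, because the
latter, as a quotient of a sigma type, already carries an unrelated preorder. -/
def OrderedLimit : Type u := DirectLimit S f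

variable (f) in
/-- The class of `a : S i` in the direct limit. -/
def OrderedLimit.mk (i : J) (a : S i) : OrderedLimit f := (⟦⟨i, a⟩⟧ : DirectLimit S f)

namespace OrderedLimit

theorem exists_eq_mk (x : OrderedLimit f) : ∃ i a, x = mk f i a := by
  obtain ⟨i, a⟩ := x
  exact ⟨i, a, rfl⟩

theorem mk_eq_mk {i j : J} {a : S i} {b : S j} :
    mk f i a = mk f j b ↔ ∃ k, ∃ (hi : i ≤ k) (hj : j ≤ k), f i k hi a = f j k hj b :=
  Quotient.eq

theorem mk_map {i j : J} (h : i ≤ j) (a : S i) : mk f j (f i j h a) = mk f i a :=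
  (DirectLimit.eq_of_le (f := f) ⟨i, a⟩ j h).symm

variable [∀ i j (h : i ≤ j), OrderHomClass (T h) (S i) (S j)]

/-- `x ≤ y` in the direct limit when this holds for representatives at a common stage. -/
instance : LE (OrderedLimit f) :=
  ⟨fun x y => ∃ i, ∃ a b : S i, x = mk f i a ∧ y = mk f i b ∧ a ≤ b⟩

theorem mk_le_mk {i j : J} {a : S i} {b : S j} :
    mk f i a ≤ mk f j b ↔ ∃ k, ∃ (hi : i ≤ k) (hj : j ≤ k), f i k hi a ≤ f j k hj b := by
  constructor
  · rintro ⟨l, a', b', ha, hb, h⟩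
    obtain ⟨p, h1, h2, ha⟩ := mk_eq_mk.1 ha
    obtain ⟨q, h3, h4, hb⟩ := mk_eq_mk.1 hb
    obtain ⟨k, hp, hq⟩ := exists_ge_ge p q
    refine ⟨k, h1.trans hp, h3.trans hq, ?_⟩
    rw [← DirectedSystem.map_map' f h1 hp, ← DirectedSystem.map_map' f h3 hq, ha, hb,
      DirectedSystem.map_map', DirectedSystem.map_map']
    exact OrderHomClass.mono (f l k _) h
  · rintro ⟨k, hi, hj, h⟩
    exact ⟨k, _, _, (mk_map hi a).symm, (mk_map hj b).symm, h⟩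

instance : PartialOrder (OrderedLimit f) where
  le_refl x := by
    obtain ⟨i, a, rfl⟩ := x.exists_eq_mk
    exact ⟨i, a, a, rfl, rfl, le_rfl⟩
  le_trans x y z h h' := by
    obtain ⟨i, a, rfl⟩ := x.exists_eq_mk
    obtain ⟨j, b, rfl⟩ := y.exists_eq_mk
    obtain ⟨l, c, rfl⟩ := z.exists_eq_mk
    obtain ⟨p, h1, h2, h⟩ := mk_le_mk.1 h
    obtain ⟨q, h3, h4, h'⟩ := mk_le_mk.1 h'
    obtain ⟨k, hp, hq⟩ := exists_ge_ge p q
    refine mk_le_mk.2 ⟨k, h1.trans hp, h4.trans hq, ?_⟩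
    have e := OrderHomClass.mono (f p k hp) h
    have e' := OrderHomClass.mono (f q k hq) h'
    simp only [DirectedSystem.map_map'] at e e'
    exact e.trans e'
  le_antisymm x y h h' := by
    obtain ⟨i, a, rfl⟩ := x.exists_eq_mk
    obtain ⟨j, b, rfl⟩ := y.exists_eq_mk
    obtain ⟨p, h1, h2, h⟩ := mk_le_mk.1 h
    obtain ⟨q, h3, h4, h'⟩ := mk_le_mk.1 h'
    obtain ⟨k, hp, hq⟩ := exists_ge_ge p q
    refine mk_eq_mk.2 ⟨k, h1.trans hp, h2.trans hp, ?_⟩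
    have e := OrderHomClass.mono (f p k hp) h
    have e' := OrderHomClass.mono (f q k hq) h'
    simp only [DirectedSystem.map_map'] at e e'
    exact le_antisymm e e'

variable (f) in
theorem isDirectLimit : IsDirectLimit (fun _ _ h => f _ _ h) (mk f) where
  mono i a b h := ⟨i, a, b, rfl, rfl, h⟩
  comp _ _ h a := mk_map h a
  surj s := by
    obtain ⟨i, a, rfl⟩ := s.exists_eq_mk
    exact ⟨i, a, rfl⟩
  le_of_le _ _ _ _ := mk_le_mk.1

end OrderedLimit

end OrderedLimit

namespace OrderedLimit

variable {J : Type u} [Preorder J] [IsDirectedOrder J] [Nonempty J] {S : J → Type u}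
  [∀ i, PartialOrder (S i)] [∀ i, AddCommMonoid (S i)] {f : ∀ i j : J, i ≤ j → S i →+o S j}
  [DirectedSystem S (f · · ·)]

noncomputable instance : AddCommMonoid (OrderedLimit f) :=
  inferInstanceAs (AddCommMonoid (DirectLimit S f))

theorem mk_zero (i : J) : mk f i 0 = 0 := (DirectLimit.zero_def (f := f) i).symm

theorem mk_add (i : J) (a b : S i) : mk f i (a + b) = mk f i a + mk f i b :=
  (DirectLimit.add_def (f := f) i a b).symm

instance [∀ i, IsOrderedAddMonoid (S i)] : IsOrderedAddMonoid (OrderedLimit f) where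
  add_le_add_left x y h z := by
    obtain ⟨i, a, b, rfl, rfl, h⟩ := h
    obtain ⟨l, c, rfl⟩ := z.exists_eq_mk
    obtain ⟨k, hi, hl⟩ := exists_ge_ge i l
    refine ⟨k, f i k hi a + f l k hl c, f i k hi b + f l k hl c, ?_, ?_,
      add_le_add_left ((f i k hi).monotone' h) _⟩ <;>
    rw [mk_add, mk_map, mk_map]

instance [∀ i, IsBotZeroClass (S i)] : IsBotZeroClass (OrderedLimit f) where
  isBot_zero x := by
    obtain ⟨i, a, rfl⟩ := x.exists_eq_mk
    exact ⟨i, 0, a, (mk_zero i).symm, rfl, IsBotZeroClass.isBot_zero a⟩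

variable (f) in
/-- The morphism from the `i`-th stage to the direct limit. -/
noncomputable def of (i : J) : S i →+o OrderedLimit f where
  toFun := mk f i
  map_zero' := mk_zero i
  map_add' := mk_add i
  monotone' := (isDirectLimit f).mono i

end OrderedLimit

/-! ### The way-below relation -/

section WayBelow

variable {S : Type u} [PartialOrder S]

theorem WayBelow.le {x y : S} (h : WayBelow x y) : x ≤ y := Web.wayBelow_le h

theorem WayBelow.trans_le {x y z : S} (h : WayBelow x y) (h' : y ≤ z) : WayBelow x z :=
  fun w hw b hb hzb => h w hw b hb (h'.trans hzb)

theorem WayBelow.of_le {x y z : S} (h : x ≤ y) (h' : WayBelow y z) : WayBelow x z := by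
  intro w hw b hb hzb
  obtain ⟨k, hk⟩ := h' w hw b hb hzb
  exact ⟨k, h.trans hk⟩

variable [AddCommMonoid S]

theorem CuAxioms.exists_seq (hS : CuAxioms S) (x : S) : ∃ z : ℕ → S, Monotone z ∧
    (∀ n, WayBelow (z n) (z (n + 1))) ∧ (∀ n, WayBelow (z n) x) ∧ IsLUB (Set.range z) x := by
  obtain ⟨z, hz, hx⟩ := hS.o2 x
  exact ⟨z, monotone_nat_of_le_succ fun n => (hz n).le, hz,
    fun n => (hz n).trans_le (hx.1 ⟨_, rfl⟩), hx⟩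

theorem CuAxioms.exists_between (hS : CuAxioms S) {x y : S} (h : WayBelow x y) :
    ∃ z, WayBelow x z ∧ WayBelow z y := by
  obtain ⟨z, hz, hz', hy, hlub⟩ := hS.exists_seq y
  obtain ⟨n, hn⟩ := h z hz y hlub le_rfl
  exact ⟨z (n + 1), (hz' n).of_le hn, hy _⟩

theorem CuAxioms.exists_wayBelow_ge (hS : CuAxioms S) {x y z : S} (hx : WayBelow x z)
    (hy : WayBelow y z) : ∃ w, WayBelow w z ∧ x ≤ w ∧ y ≤ w := by
  obtain ⟨w, hw, hw', hz, hlub⟩ := hS.exists_seq z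
  obtain ⟨n, hn⟩ := hx w hw z hlub le_rfl
  obtain ⟨m, hm⟩ := hy w hw z hlub le_rfl
  exact ⟨w (max n m), hz _, hn.trans (hw (le_max_left _ _)), hm.trans (hw (le_max_right _ _))⟩

end WayBelow

namespace CuHom

variable {S T : Type u} [PartialOrder S] [AddCommMonoid S] [PartialOrder T] [AddCommMonoid T]

theorem mono (g : CuHom S T) : Monotone g := g.monotone'

theorem wayBelow (g : CuHom S T) {x y : S} (h : WayBelow x y) : WayBelow (g x) (g y) :=
  g.map_wayBelow x y h

theorem isLUB (g : CuHom S T) {z : ℕ → S} (hz : Monotone z) {b : S}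
    (h : IsLUB (Set.range z) b) : IsLUB (Set.range fun n => g (z n)) (g b) :=
  g.map_isLUB z hz b h

instance : AddMonoidHomClass (CuHom S T) S T where
  map_add g := g.map_add'
  map_zero g := g.map_zero'

end CuHom

/-! ### Colimits of abstract Cuntz semigroups -/

/-- The criterion for a compatible family `α` to be a colimit in the categories `Cu` and `Cu*`:
the images of the stages are dense for `≪`, and an inequality in the colimit holds at some stage
once its left-hand side is replaced by an element way below it. -/
structure IsCuLimit {J : Type u} [Preorder J] {S : J → Type u} [∀ i, PartialOrder (S i)]
    [∀ i, AddCommMonoid (S i)] (f : ∀ ⦃i j : J⦄, i ≤ j → CuHom (S i) (S j))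
    {A : Type u} [PartialOrder A] [AddCommMonoid A] (α : ∀ i, CuHom (S i) A) : Prop where
  comp : ∀ ⦃i j⦄ (h : i ≤ j) (a : S i), α j (f h a) = α i a
  dense : ∀ ⦃s t⦄, WayBelow s t → ∃ i a, s ≤ α i a ∧ α i a ≤ t
  le_of_le : ∀ ⦃i j⦄ (a' a : S i) (b : S j), WayBelow a' a → α i a ≤ α j b →
    ∃ k, ∃ (hi : i ≤ k) (hj : j ≤ k), f hi a' ≤ f hj b

section

variable {J : Type u} [Preorder J] [IsDirectedOrder J] {S : J → Type u}
  [∀ i, PartialOrder (S i)] [∀ i, AddCommMonoid (S i)]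
  {A : Type u} [PartialOrder A] [AddCommMonoid A]

/-- `Approx f α s i a` holds when, at some later stage, `a` is way below an element that `α` maps
below `s`. This is stronger than `α i a ≪ s`: since the stages reflect inequalities in the colimit
only up to `≪`, some room at a stage is needed for these pairs `(i, a)` to be directed. -/
def Approx (f : ∀ ⦃i j : J⦄, i ≤ j → CuHom (S i) (S j)) (α : ∀ i, CuHom (S i) A) (s : A) (i : J)
    (a : S i) : Prop :=
  ∃ k, ∃ h : i ≤ k, ∃ c : S k, WayBelow (f h a) c ∧ α k c ≤ s

variable {f : ∀ ⦃i j : J⦄, i ≤ j → CuHom (S i) (S j)} {α : ∀ i, CuHom (S i) A}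

namespace IsCuLimit

theorem approx_le (hα : IsCuLimit f α) {s : A} {i : J} {a : S i} (h : Approx f α s i a) :
    α i a ≤ s := by
  obtain ⟨k, hi, c, h, h'⟩ := h
  rw [← hα.comp hi]
  exact ((α k).mono h.le).trans h'

theorem approx_mono {s t : A} (hst : s ≤ t) {i : J} {a : S i} (h : Approx f α s i a) :
    Approx f α t i a := by
  obtain ⟨k, hi, c, h, h'⟩ := h
  exact ⟨k, hi, c, h, h'.trans hst⟩

theorem approx_map (hf : IsSystem fun _ _ h => f h) (hα : IsCuLimit f α) {s : A} {i j : J}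
    (hij : i ≤ j) {a : S i} (h : Approx f α s i a) : Approx f α s j (f hij a) := by
  obtain ⟨k, hi, c, h, h'⟩ := h
  obtain ⟨l, hj, hk⟩ := exists_ge_ge j k
  refine ⟨l, hj, f hk c, ?_, by rwa [hα.comp]⟩
  rw [hf.comp hij hj, ← hf.comp hi hk]
  exact (f hk).wayBelow h

theorem approx_self (hf : IsSystem fun _ _ h => f h) {i : J} {a' a : S i} (h : WayBelow a' a) :
    Approx f α (α i a) i a' :=
  ⟨i, le_rfl, a, by rwa [hf.id], le_rfl⟩

theorem le_of_approx (hf : IsSystem fun _ _ h => f h) (hα : IsCuLimit f α) {i j : J} {a : S i}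
    {b : S j} (h : Approx f α (α j b) i a) :
    ∃ k, ∃ (hi : i ≤ k) (hj : j ≤ k), f hi a ≤ f hj b := by
  obtain ⟨l, hi, c, h, h'⟩ := h
  obtain ⟨k, hl, hj, hk⟩ := hα.le_of_le _ _ _ h h'
  exact ⟨k, hi.trans hl, hj, by rwa [← hf.comp hi hl]⟩

/-- The elements approximating `s` contain a cofinal increasing sequence. -/
theorem exists_approx_seq (hf : IsSystem fun _ _ h => f h) (hS : ∀ i, CuAxioms (S i))
    (hA : CuAxioms A) (hα : IsCuLimit f α) (s : A) :
    ∃ (r : ℕ → J) (d : ∀ n, S (r n)), (∀ n, Approx f α s (r n) (d n)) ∧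
      (∀ n m, n ≤ m → ∃ k, ∃ (h : r n ≤ k) (h' : r m ≤ k), f h (d n) ≤ f h' (d m)) ∧
      (∀ i a, Approx f α s i a → ∃ n, ∃ k, ∃ (h : i ≤ k) (h' : r n ≤ k), f h a ≤ f h' (d n)) ∧
      IsLUB (Set.range fun n => α (r n) (d n)) s := by
  obtain ⟨z, hz, hzz, hzs, hlub⟩ := hA.exists_seq s
  choose r c hc hc' using fun n => hα.dense (hzz (2 * n + 1))
  -- `z (2 n) ≪ z (2 n + 1) ≤ α (c n)`, so `z (2 n)` lies below the image of some `d n ≪ c n`.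
  have hd : ∀ n, ∃ d : S (r n), WayBelow d (c n) ∧ z (2 * n) ≤ α (r n) d := by
    intro n
    obtain ⟨w, hw, -, hwc, hwlub⟩ := (hS (r n)).exists_seq (c n)
    obtain ⟨m, hm⟩ := hzz (2 * n) _ (fun _ _ h => (α (r n)).mono (hw h)) _
      ((α (r n)).isLUB hw hwlub) (hc n)
    exact ⟨w m, hwc m, hm⟩
  choose d hd hd' using hd
  have happ : ∀ n, Approx f α s (r n) (d n) := fun n =>
    approx_mono ((hc' n).trans (hlub.1 ⟨_, rfl⟩)) (approx_self hf (hd n))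
  have hmono : Monotone fun n => α (r n) (d n) := by
    refine monotone_nat_of_le_succ fun n => ((α (r n)).mono (hd n).le).trans ?_
    exact (hc' n).trans (hd' (n + 1))
  have hcof : ∀ i a, Approx f α s i a →
      ∃ n, ∃ k, ∃ (h : i ≤ k) (h' : r n ≤ k), f h a ≤ f h' (d n) := by
    rintro i a ⟨k, hi, e, h, h'⟩
    obtain ⟨e', he, he'⟩ := (hS k).exists_between h
    obtain ⟨m, hm⟩ := (α k).wayBelow he' z hz s hlub h'
    obtain ⟨l, hl, hl', hle⟩ := hα.le_of_le _ e' (d m) he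
      ((hm.trans (hz (by omega))).trans (hd' m))
    exact ⟨m, l, hi.trans hl, hl', by rwa [← hf.comp hi hl]⟩
  refine ⟨r, d, happ, fun n m hnm => ?_, hcof, ?_, fun t ht => hlub.2 ?_⟩
  · rcases hnm.eq_or_lt with rfl | hnm
    · exact ⟨r n, le_rfl, le_rfl, le_rfl⟩
    · refine hα.le_of_le _ _ _ (hd n) ?_
      exact ((hc' n).trans (hz (by omega))).trans (hd' m)
  · rintro _ ⟨n, rfl⟩
    exact hα.approx_le (happ n)
  · rintro _ ⟨n, rfl⟩
    exact ((hz (by omega : n ≤ 2 * n)).trans (hd' n)).trans (ht ⟨n, rfl⟩)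

theorem approx_directed (hf : IsSystem fun _ _ h => f h) (hS : ∀ i, CuAxioms (S i))
    (hA : CuAxioms A) (hα : IsCuLimit f α) {s : A} {i j : J} {a : S i} {b : S j}
    (ha : Approx f α s i a) (hb : Approx f α s j b) :
    ∃ k, ∃ (hi : i ≤ k) (hj : j ≤ k), ∃ c, Approx f α s k c ∧ f hi a ≤ c ∧ f hj b ≤ c := by
  obtain ⟨r, d, hd, hmono, hcof, -⟩ := hα.exists_approx_seq hf hS hA s
  have aux : ∀ {i} {a : S i} {n m}, n ≤ m →
      (∃ k, ∃ (h : i ≤ k) (h' : r n ≤ k), f h a ≤ f h' (d n)) →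
      ∃ k, ∃ (h : i ≤ k) (h' : r m ≤ k), f h a ≤ f h' (d m) := by
    rintro i a n m hnm ⟨p, hp, hp', h⟩
    obtain ⟨q, hq, hq', h'⟩ := hmono n m hnm
    obtain ⟨k, hpk, hqk⟩ := exists_ge_ge p q
    refine ⟨k, hp.trans hpk, hq'.trans hqk, ?_⟩
    rw [← hf.comp hp hpk, ← hf.comp hq' hqk]
    refine ((f hpk).mono h).trans ((hf.comp hp' hpk _).trans_le ?_)
    exact (hf.comp hq hqk _).symm.trans_le ((f hqk).mono h')
  obtain ⟨n, hn⟩ := hcof i a ha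
  obtain ⟨m, hm⟩ := hcof j b hb
  obtain ⟨p, hp, hp', h⟩ := aux (le_max_left n m) hn
  obtain ⟨q, hq, hq', h'⟩ := aux (le_max_right n m) hm
  obtain ⟨k, hpk, hqk⟩ := exists_ge_ge p q
  refine ⟨k, hp.trans hpk, hq.trans hqk, f (hp'.trans hpk) (d (max n m)),
    hα.approx_map hf _ (hd _), ?_, ?_⟩
  · rw [← hf.comp hp hpk, ← hf.comp hp' hpk]
    exact (f hpk).mono h
  · rw [← hf.comp hq hqk, ← hf.comp hq' hqk]
    exact (f hqk).mono h'

variable {T : Type u} [PartialOrder T] [AddCommMonoid T] {τ : ∀ i, CuHom (S i) T}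

/-- Morphisms out of a colimit are determined by their restrictions to the stages. -/
theorem hom_ext (hf : IsSystem fun _ _ h => f h) (hS : ∀ i, CuAxioms (S i))
    (hA : CuAxioms A) (hα : IsCuLimit f α) {γ γ' : CuHom A T}
    (h : ∀ i a, γ (α i a) = γ' (α i a)) : γ = γ' := by
  refine DFunLike.ext _ _ fun s => ?_
  obtain ⟨r, d, -, hmono, -, hlub⟩ := hα.exists_approx_seq hf hS hA s
  have hmono' : Monotone fun n => α (r n) (d n) := by
    intro n m hnm
    obtain ⟨k, h, h', hk⟩ := hmono n m hnm
    change α (r n) (d n) ≤ α (r m) (d m)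
    rw [← hα.comp h, ← hα.comp h']
    exact (α k).mono hk
  have h1 := γ.isLUB hmono' hlub
  have h2 := γ'.isLUB hmono' hlub
  simp only [h] at h1
  exact h1.unique h2

/-- The universal property of the colimit of abstract Cuntz semigroups: `s` is sent to the supremum
of the images of the elements approximating `s`. -/
theorem exists_desc [Nonempty J] [IsOrderedAddMonoid A] (hf : IsSystem fun _ _ h => f h)
    (hS : ∀ i, CuAxioms (S i)) (hA : CuAxioms A) (hα : IsCuLimit f α) (hT : CuAxioms T)
    (hτ : ∀ ⦃i j⦄ (h : i ≤ j) (a : S i), τ j (f h a) = τ i a) :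
    ∃ γ : CuHom A T, ∀ i a, γ (α i a) = τ i a := by
  have hle : ∀ {i j k} {a : S i} {b : S j} (hi : i ≤ k) (hj : j ≤ k), f hi a ≤ f hj b →
      τ i a ≤ τ j b := by
    intro i j k a b hi hj h
    rw [← hτ hi, ← hτ hj]
    exact (τ k).mono h
  have hα' : ∀ {i j k} {a : S i} {b : S j} (hi : i ≤ k) (hj : j ≤ k), f hi a ≤ f hj b →
      α i a ≤ α j b := by
    intro i j k a b hi hj h
    rw [← hα.comp hi, ← hα.comp hj]
    exact (α k).mono h
  let D : A → Set T := fun s => {t | ∃ i a, Approx f α s i a ∧ τ i a = t}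
  have hex : ∀ s, ∃ t, IsLUB (D s) t := by
    intro s
    obtain ⟨r, d, hd, hmono, hcof, -⟩ := hα.exists_approx_seq hf hS hA s
    obtain ⟨t, ht⟩ := hT.o1 (fun n => τ (r n) (d n)) (by
      intro n m hnm
      obtain ⟨k, h, h', hk⟩ := hmono n m hnm
      exact hle h h' hk)
    refine ⟨t, ?_, fun b hb => ht.2 ?_⟩
    · rintro _ ⟨i, a, ha, rfl⟩
      obtain ⟨n, k, h, h', hk⟩ := hcof i a ha
      exact (hle h h' hk).trans (ht.1 ⟨n, rfl⟩)
    · rintro _ ⟨n, rfl⟩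
      exact hb ⟨_, _, hd n, rfl⟩
  choose γ hγ using hex
  have hmono : Monotone γ := fun s t h => (hγ s).2 (by
    rintro _ ⟨i, a, ha, rfl⟩
    exact (hγ t).1 ⟨i, a, approx_mono h ha, rfl⟩)
  have hγα : ∀ i a, γ (α i a) = τ i a := by
    intro i a
    apply le_antisymm
    · refine (hγ _).2 ?_
      rintro _ ⟨j, b, hb, rfl⟩
      obtain ⟨k, h, h', hk⟩ := hα.le_of_approx hf hb
      exact hle h h' hk
    · obtain ⟨w, hw, -, hwa, hwlub⟩ := (hS i).exists_seq a
      refine ((τ i).isLUB hw hwlub).2 ?_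
      rintro _ ⟨n, rfl⟩
      exact (hγ _).1 ⟨i, w n, approx_self hf (hwa n), rfl⟩
  have hlub : ∀ z : ℕ → A, Monotone z → ∀ b, IsLUB (Set.range z) b →
      IsLUB (Set.range fun n => γ (z n)) (γ b) := by
    intro z hz b hb
    refine ⟨?_, fun t ht => (hγ b).2 ?_⟩
    · rintro _ ⟨n, rfl⟩
      exact hmono (hb.1 ⟨n, rfl⟩)
    · rintro _ ⟨i, a, ⟨k, hi, c, h, h'⟩, rfl⟩
      obtain ⟨c', hc, hc'⟩ := (hS k).exists_between h
      obtain ⟨n, hn⟩ := (α k).wayBelow hc' z hz b hb h'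
      exact ((hγ (z n)).1 ⟨i, a, ⟨k, hi, c', hc, hn⟩, rfl⟩).trans (ht ⟨n, rfl⟩)
  refine ⟨⟨⟨⟨⟨γ, ?_⟩, fun s t => ?_⟩, hmono⟩, fun s t h => ?_, hlub⟩, hγα⟩
  · obtain ⟨i⟩ := ‹Nonempty J›
    have := hγα i 0
    rwa [map_zero, map_zero] at this
  · change γ (s + t) = γ s + γ t
    obtain ⟨r, d, -, hd, -, hs⟩ := hα.exists_approx_seq hf hS hA s
    obtain ⟨r', d', -, hd', -, ht⟩ := hα.exists_approx_seq hf hS hA t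
    have hmd : Monotone fun n => α (r n) (d n) := by
      intro n m hnm
      obtain ⟨k, h, h', hk⟩ := hd n m hnm
      exact hα' h h' hk
    have hmd' : Monotone fun n => α (r' n) (d' n) := by
      intro n m hnm
      obtain ⟨k, h, h', hk⟩ := hd' n m hnm
      exact hα' h h' hk
    have hadd : ∀ n, ∃ k c, α (r n) (d n) + α (r' n) (d' n) = α k c ∧
        τ (r n) (d n) + τ (r' n) (d' n) = τ k c := by
      intro n
      obtain ⟨k, h, h'⟩ := exists_ge_ge (r n) (r' n)
      refine ⟨k, f h (d n) + f h' (d' n), ?_, ?_⟩ <;>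
        simp only [map_add, hα.comp, hτ]
    have hsum : ∀ n, γ (α (r n) (d n) + α (r' n) (d' n)) =
        γ (α (r n) (d n)) + γ (α (r' n) (d' n)) := by
      intro n
      obtain ⟨k, c, h, h'⟩ := hadd n
      rw [h, hγα, hγα, hγα, h']
    have hmsum : Monotone fun n => α (r n) (d n) + α (r' n) (d' n) :=
      fun _ _ h => add_le_add (hmd h) (hmd' h)
    -- By (O4), `γ (s + t)` and `γ s + γ t` are suprema of the same sequence.
    have h1 := hlub _ hmsum _ (hA.o4 _ _ hmd hmd' _ _ hs ht)
    have h2 := hT.o4 _ _ (fun _ _ h => hmono (hmd h)) (fun _ _ h => hmono (hmd' h)) _ _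
      (hlub _ hmd _ hs) (hlub _ hmd' _ ht)
    simp only [hsum] at h1
    exact h1.unique h2
  · change WayBelow (γ s) (γ t)
    -- Some `b` at a stage satisfies `s ≪ α b ≤ t`, so `s ≤ α (w m)` with `w m ≪ b`, and `τ`
    -- preserves this last relation.
    obtain ⟨u, hu, hu'⟩ := hA.exists_between h
    obtain ⟨i, a, ha, ha'⟩ := hα.dense hu
    obtain ⟨z, hz, hzz, hzt, hlubz⟩ := hA.exists_seq t
    obtain ⟨n, hn⟩ := hu' z hz t hlubz le_rfl
    obtain ⟨j, b, hb, hb'⟩ := hα.dense (hzz n)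
    obtain ⟨w, hw, -, hwb, hlubw⟩ := (hS j).exists_seq b
    have h1 : WayBelow s (α j b) := (hu.trans_le (hn.trans hb))
    obtain ⟨m, hm⟩ := h1 _ (fun _ _ h => (α j).mono (hw h)) _ ((α j).isLUB hw hlubw) le_rfl
    have h2 : γ s ≤ τ j (w m) := (hmono hm).trans (hγα _ _).le
    have h3 : τ j b ≤ γ t := (hγα _ _).ge.trans (hmono (hb'.trans (hlubz.1 ⟨_, rfl⟩)))
    exact (((τ j).wayBelow (hwb m)).of_le h2).trans_le h3

end IsCuLimit

end

/-! ### The completion of a positively ordered monoid with an auxiliary relation -/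

/-- An additive auxiliary relation `R` on a positively ordered monoid, to be thought of as the
restriction of `≪` to a dense submonoid of an abstract Cuntz semigroup. -/
class IsAuxiliary {M : Type u} [PartialOrder M] [AddCommMonoid M] (R : M → M → Prop) : Prop where
  le : ∀ {x y}, R x y → x ≤ y
  of_le : ∀ {x y z}, x ≤ y → R y z → R x z
  trans_le : ∀ {x y z}, R x y → y ≤ z → R x z
  zero : R 0 0
  add : ∀ {x y z w}, R x y → R z w → R (x + z) (y + w)
  exists_seq : ∀ x, ∃ z : ℕ → M, (∀ n, R (z n) (z (n + 1))) ∧ (∀ n, R (z n) x) ∧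
    ∀ y, R y x → ∃ n, y ≤ z n
  exists_add : ∀ {x y z}, R x (y + z) → ∃ y' z', R y' y ∧ R z' z ∧ x ≤ y' + z'

/-- A countably generated round ideal. -/
structure RoundIdeal {M : Type u} [PartialOrder M] (R : M → M → Prop) where
  /-- The underlying set. -/
  carrier : Set M
  lower : ∀ {x y}, x ≤ y → y ∈ carrier → x ∈ carrier
  nonempty : carrier.Nonempty
  directed : ∀ {x y}, x ∈ carrier → y ∈ carrier → ∃ z ∈ carrier, R x z ∧ R y z
  countable : ∃ c : ℕ → M, (∀ n, c n ∈ carrier) ∧ ∀ x ∈ carrier, ∃ n, x ≤ c n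

namespace RoundIdeal

section Order

variable {M : Type u} [PartialOrder M] {R : M → M → Prop}

instance : SetLike (RoundIdeal R) M where
  coe := carrier
  coe_injective I K h := by
    cases I
    cases K
    cases h
    rfl

/-- Round ideals are ordered by inclusion. -/
instance : PartialOrder (RoundIdeal R) := PartialOrder.ofSetLike (RoundIdeal R) M

theorem exists_rel {I : RoundIdeal R} {x : M} (h : x ∈ I) : ∃ y ∈ I, R x y := by
  obtain ⟨y, hy, h, -⟩ := I.directed h h
  exact ⟨y, hy, h⟩

/-- The union of an increasing sequence of round ideals. -/
def iUnion (I : ℕ → RoundIdeal R) (hI : Monotone I) : RoundIdeal R where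
  carrier := {x | ∃ n, x ∈ I n}
  lower := fun h ⟨n, hn⟩ => ⟨n, (I n).lower h hn⟩
  nonempty := (I 0).nonempty.mono fun x hx => ⟨0, hx⟩
  directed := by
    rintro x y ⟨n, hn⟩ ⟨m, hm⟩
    obtain ⟨z, hz, h⟩ := (I (max n m)).directed (hI (le_max_left n m) hn) (hI (le_max_right n m) hm)
    exact ⟨z, ⟨_, hz⟩, h⟩
  countable := by
    choose c hc hc' using fun n => (I n).countable
    refine ⟨fun n => c n.unpair.1 n.unpair.2, fun n => ⟨_, hc _ _⟩, ?_⟩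
    rintro x ⟨n, hn⟩
    obtain ⟨m, hm⟩ := hc' n x hn
    exact ⟨Nat.pair n m, by simpa using hm⟩

theorem mem_iUnion {I : ℕ → RoundIdeal R} {hI : Monotone I} {x : M} :
    x ∈ iUnion I hI ↔ ∃ n, x ∈ I n := Iff.rfl

theorem isLUB_iUnion (I : ℕ → RoundIdeal R) (hI : Monotone I) :
    IsLUB (Set.range I) (iUnion I hI) := by
  refine ⟨?_, fun K hK => ?_⟩
  · rintro _ ⟨n, rfl⟩ x hx
    exact ⟨n, hx⟩
  · rintro x ⟨n, hn⟩
    exact hK ⟨n, rfl⟩ hn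

/-- Suprema of increasing sequences of round ideals are unions. -/
theorem isLUB_iff {I : ℕ → RoundIdeal R} (hI : Monotone I) {K : RoundIdeal R} :
    IsLUB (Set.range I) K ↔ ∀ x, x ∈ K ↔ ∃ n, x ∈ I n := by
  constructor
  · intro h x
    rw [h.unique (isLUB_iUnion I hI), mem_iUnion]
  · intro h
    have : K = iUnion I hI := SetLike.ext h
    rw [this]
    exact isLUB_iUnion I hI

end Order

section Monoid

variable {M : Type u} [PartialOrder M] [AddCommMonoid M] {R : M → M → Prop} [IsAuxiliary R]

variable (R) in
/-- The round ideal of the elements below `x` for `R`. -/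
def below (x : M) : RoundIdeal R where
  carrier := {y | R y x}
  lower := IsAuxiliary.of_le
  nonempty := by
    obtain ⟨z, -, hz, -⟩ := IsAuxiliary.exists_seq (R := R) x
    exact ⟨z 0, hz 0⟩
  directed := by
    intro y y' hy hy'
    obtain ⟨z, hz, hzx, h⟩ := IsAuxiliary.exists_seq (R := R) x
    have hm : Monotone z := monotone_nat_of_le_succ fun n => IsAuxiliary.le (hz n)
    obtain ⟨n, hn⟩ := h y hy
    obtain ⟨m, hm'⟩ := h y' hy'
    exact ⟨z (max n m + 1), hzx _,
      IsAuxiliary.of_le (hn.trans (hm (le_max_left n m))) (hz _),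
      IsAuxiliary.of_le (hm'.trans (hm (le_max_right n m))) (hz _)⟩
  countable := by
    obtain ⟨z, -, hz, h⟩ := IsAuxiliary.exists_seq (R := R) x
    exact ⟨z, hz, h⟩

theorem below_mono {x y : M} (h : x ≤ y) : below R x ≤ below R y :=
  fun _ hz => IsAuxiliary.trans_le hz h

theorem below_le {I : RoundIdeal R} {x : M} (h : x ∈ I) : below R x ≤ I :=
  fun _ hz => I.lower (IsAuxiliary.le hz) h

/-- Every round ideal is the union of an increasing sequence of ideals `below R (z n)`. -/
theorem exists_below_seq (I : RoundIdeal R) : ∃ z : ℕ → M, (∀ n, z n ∈ I) ∧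
    (∀ n, R (z n) (z (n + 1))) ∧ IsLUB (Set.range fun n => below R (z n)) I := by
  obtain ⟨c, hc, hI⟩ := I.countable
  choose g hg hg' hg'' using fun x y : I => I.directed x.2 y.2
  obtain ⟨z, hz⟩ : ∃ z : ℕ → I, ∀ n, R (z n) (z (n + 1)) ∧ R (c n) (z (n + 1)) :=
    ⟨Nat.rec ⟨c 0, hc 0⟩ fun n x => ⟨g x ⟨c n, hc n⟩, hg _ _⟩,
      fun n => ⟨hg' _ ⟨c n, hc n⟩, hg'' _ ⟨c n, hc n⟩⟩⟩
  have hm : Monotone fun n => below R (z n : M) :=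
    monotone_nat_of_le_succ fun n => below_mono (IsAuxiliary.le (hz n).1)
  refine ⟨fun n => z n, fun n => (z n).2, fun n => (hz n).1,
    (isLUB_iff hm).2 fun x => ⟨fun hx => ?_, ?_⟩⟩
  · obtain ⟨n, hn⟩ := hI x hx
    exact ⟨n + 1, IsAuxiliary.of_le hn (hz n).2⟩
  · rintro ⟨n, hn⟩
    exact below_le (z n).2 hn

theorem wayBelow_iff {I K : RoundIdeal R} : WayBelow I K ↔ ∃ x ∈ K, ∀ y ∈ I, y ≤ x := by
  constructor
  · intro h
    obtain ⟨z, hz, hzz, hlub⟩ := K.exists_below_seq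
    obtain ⟨n, hn⟩ := h _ (monotone_nat_of_le_succ fun n => below_mono (IsAuxiliary.le (hzz n)))
      _ hlub le_rfl
    exact ⟨z n, hz n, fun y hy => IsAuxiliary.le (hn hy)⟩
  · rintro ⟨x, hx, hI⟩ Z hZ B hB hKB
    obtain ⟨n, hn⟩ := ((isLUB_iff hZ).1 hB x).1 (hKB hx)
    exact ⟨n, fun y hy => (Z n).lower (hI y hy) hn⟩

theorem below_wayBelow {I : RoundIdeal R} {x : M} (h : x ∈ I) : WayBelow (below R x) I :=
  wayBelow_iff.2 ⟨x, h, fun _ hy => IsAuxiliary.le hy⟩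

variable [IsOrderedAddMonoid M]

/-- The sum of two round ideals is the lower set generated by their elementwise sum. -/
instance : Add (RoundIdeal R) where
  add I K :=
    { carrier := {x | ∃ a ∈ I, ∃ b ∈ K, x ≤ a + b}
      lower := fun h ⟨a, ha, b, hb, h'⟩ => ⟨a, ha, b, hb, h.trans h'⟩
      nonempty := by
        obtain ⟨a, ha⟩ := I.nonempty
        obtain ⟨b, hb⟩ := K.nonempty
        exact ⟨_, a, ha, b, hb, le_rfl⟩
      directed := by
        rintro x y ⟨a, ha, b, hb, h⟩ ⟨c, hc, d, hd, h'⟩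
        obtain ⟨e, he, h1, h2⟩ := I.directed ha hc
        obtain ⟨g, hg, h3, h4⟩ := K.directed hb hd
        exact ⟨e + g, ⟨e, he, g, hg, le_rfl⟩, IsAuxiliary.of_le h (IsAuxiliary.add h1 h3),
          IsAuxiliary.of_le h' (IsAuxiliary.add h2 h4)⟩
      countable := by
        obtain ⟨c, hc, hI⟩ := I.countable
        obtain ⟨d, hd, hK⟩ := K.countable
        refine ⟨fun n => c n.unpair.1 + d n.unpair.2, fun n => ⟨_, hc _, _, hd _, le_rfl⟩, ?_⟩
        rintro x ⟨a, ha, b, hb, h⟩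
        obtain ⟨n, hn⟩ := hI a ha
        obtain ⟨m, hm⟩ := hK b hb
        exact ⟨Nat.pair n m, by simpa using h.trans (add_le_add hn hm)⟩ }

theorem mem_add {I K : RoundIdeal R} {x : M} : x ∈ I + K ↔ ∃ a ∈ I, ∃ b ∈ K, x ≤ a + b := Iff.rfl

instance : Zero (RoundIdeal R) := ⟨below R 0⟩

variable [IsBotZeroClass M]

theorem mem_zero {x : M} : x ∈ (0 : RoundIdeal R) ↔ x = 0 := by
  refine ⟨fun h => le_antisymm (IsAuxiliary.le h) (IsBotZeroClass.isBot_zero x), ?_⟩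
  rintro rfl
  exact IsAuxiliary.zero

theorem zero_mem (I : RoundIdeal R) : (0 : M) ∈ I := by
  obtain ⟨x, hx⟩ := I.nonempty
  exact I.lower (IsBotZeroClass.isBot_zero x) hx

instance : AddCommMonoid (RoundIdeal R) where
  add_assoc I K L := by
    refine SetLike.ext fun x => ⟨?_, ?_⟩
    · rintro ⟨y, ⟨a, ha, b, hb, h⟩, c, hc, h'⟩
      exact ⟨a, ha, b + c, ⟨b, hb, c, hc, le_rfl⟩,
        h'.trans ((add_le_add_left h c).trans (add_assoc a b c).le)⟩
    · rintro ⟨a, ha, y, ⟨b, hb, c, hc, h⟩, h'⟩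
      exact ⟨a + b, ⟨a, ha, b, hb, le_rfl⟩, c, hc,
        h'.trans ((add_le_add_right h a).trans (add_assoc a b c).ge)⟩
  add_comm I K := by
    refine SetLike.ext fun x => ⟨?_, ?_⟩ <;>
    · rintro ⟨a, ha, b, hb, h⟩
      exact ⟨b, hb, a, ha, h.trans (add_comm a b).le⟩
  zero_add I := by
    refine SetLike.ext fun x => ⟨?_, fun hx =>
      mem_add.2 ⟨0, mem_zero.2 rfl, x, hx, (zero_add x).ge⟩⟩
    rintro ⟨a, ha, b, hb, h⟩
    rw [mem_zero.1 ha, zero_add] at h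
    exact I.lower h hb
  add_zero I := by
    refine SetLike.ext fun x => ⟨?_, fun hx =>
      mem_add.2 ⟨x, hx, 0, mem_zero.2 rfl, (add_zero x).ge⟩⟩
    rintro ⟨a, ha, b, hb, h⟩
    rw [mem_zero.1 hb, add_zero] at h
    exact I.lower h ha
  nsmul := nsmulRec

instance : IsOrderedAddMonoid (RoundIdeal R) where
  add_le_add_left _ _ h _ := fun _ ⟨a, ha, b, hb, h'⟩ => ⟨a, h ha, b, hb, h'⟩

instance : IsBotZeroClass (RoundIdeal R) where
  isBot_zero I := fun x hx => by
    rw [mem_zero.1 hx]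
    exact I.zero_mem

theorem below_add (x y : M) : below R (x + y) = below R x + below R y := by
  refine SetLike.ext fun z => ⟨fun h => ?_, ?_⟩
  · obtain ⟨a, b, ha, hb, h⟩ := IsAuxiliary.exists_add (R := R) h
    exact ⟨a, ha, b, hb, h⟩
  · rintro ⟨a, ha, b, hb, h⟩
    exact IsAuxiliary.of_le h (IsAuxiliary.add ha hb)

/-- The completion is an abstract Cuntz semigroup. -/
theorem cuAxioms : CuAxioms (RoundIdeal R) where
  o1 I hI := ⟨_, isLUB_iUnion I hI⟩
  o2 I := by
    obtain ⟨z, -, hz, h⟩ := I.exists_below_seq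
    exact ⟨_, fun n => below_wayBelow (hz n), h⟩
  o3 I' I K' K hI hK := by
    obtain ⟨x, hx, hI⟩ := wayBelow_iff.1 hI
    obtain ⟨y, hy, hK⟩ := wayBelow_iff.1 hK
    refine wayBelow_iff.2 ⟨x + y, ⟨x, hx, y, hy, le_rfl⟩, ?_⟩
    rintro z ⟨a, ha, b, hb, h⟩
    exact h.trans (add_le_add (hI a ha) (hK b hb))
  o4 V W hV hW A B hA hB := by
    refine (isLUB_iff fun _ _ h => add_le_add (hV h) (hW h)).2 fun x => ⟨?_, ?_⟩
    · rintro ⟨a, ha, b, hb, h⟩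
      obtain ⟨n, hn⟩ := ((isLUB_iff hV).1 hA a).1 ha
      obtain ⟨m, hm⟩ := ((isLUB_iff hW).1 hB b).1 hb
      exact ⟨max n m, a, hV (le_max_left n m) hn, b, hW (le_max_right n m) hm, h⟩
    · rintro ⟨n, a, ha, b, hb, h⟩
      exact ⟨a, hA.1 ⟨n, rfl⟩ ha, b, hB.1 ⟨n, rfl⟩ hb, h⟩

end Monoid

end RoundIdeal

/-! ### Existence of colimits of abstract Cuntz semigroups -/

section CuLimit

variable {J : Type u} [Preorder J] [IsDirectedOrder J] [Nonempty J] {S : J → Type u}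
  [∀ i, PartialOrder (S i)] [∀ i, AddCommMonoid (S i)] [∀ i, IsOrderedAddMonoid (S i)]
  [∀ i, IsBotZeroClass (S i)] (f : ∀ i j : J, i ≤ j → S i →+o S j) [DirectedSystem S (f · · ·)]

/-- The auxiliary relation on the algebraic direct limit of a system of abstract Cuntz semigroups:
`x` and `y` have representatives at a common stage, the first way below the second. -/
def LimitRel (x y : OrderedLimit f) : Prop :=
  ∃ i, ∃ a b : S i, x = .mk f i a ∧ y = .mk f i b ∧ WayBelow a b

variable {f}

theorem limitRel_mk (hw : ∀ i j h, ∀ a b : S i, WayBelow a b → WayBelow (f i j h a) (f i j h b))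
    {i j : J} {a : S i} {b : S j} : LimitRel f (.mk f i a) (.mk f j b) ↔
      ∃ k, ∃ (hi : i ≤ k) (hj : j ≤ k), WayBelow (f i k hi a) (f j k hj b) := by
  constructor
  · rintro ⟨l, a', b', ha, hb, h⟩
    obtain ⟨p, h1, h2, ha⟩ := OrderedLimit.mk_eq_mk.1 ha
    obtain ⟨q, h3, h4, hb⟩ := OrderedLimit.mk_eq_mk.1 hb
    obtain ⟨k, hp, hq⟩ := exists_ge_ge p q
    refine ⟨k, h1.trans hp, h3.trans hq, ?_⟩
    rw [← DirectedSystem.map_map' f h1 hp, ← DirectedSystem.map_map' f h3 hq, ha, hb,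
      DirectedSystem.map_map', DirectedSystem.map_map']
    exact hw _ _ _ _ _ h
  · rintro ⟨k, hi, hj, h⟩
    exact ⟨k, _, _, (OrderedLimit.mk_map hi a).symm, (OrderedLimit.mk_map hj b).symm, h⟩

theorem isAuxiliary_limitRel (hS : ∀ i, CuAxioms (S i))
    (hw : ∀ i j h, ∀ a b : S i, WayBelow a b → WayBelow (f i j h a) (f i j h b))
    (hl : ∀ i j h, ∀ z : ℕ → S i, Monotone z → ∀ b, IsLUB (Set.range z) b →
      IsLUB (Set.range fun n => f i j h (z n)) (f i j h b)) :
    IsAuxiliary (LimitRel f) where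
  le := by
    rintro _ _ ⟨i, a, b, rfl, rfl, h⟩
    exact ⟨i, a, b, rfl, rfl, h.le⟩
  of_le := by
    rintro x y z hxy ⟨i, a, b, rfl, rfl, h⟩
    obtain ⟨j, c, rfl⟩ := x.exists_eq_mk
    obtain ⟨k, hj, hi, h'⟩ := OrderedLimit.mk_le_mk.1 hxy
    exact (limitRel_mk hw).2 ⟨k, hj, hi, (hw _ _ _ _ _ h).of_le h'⟩
  trans_le := by
    rintro x y z ⟨i, a, b, rfl, rfl, h⟩ hyz
    obtain ⟨j, c, rfl⟩ := z.exists_eq_mk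
    obtain ⟨k, hi, hj, h'⟩ := OrderedLimit.mk_le_mk.1 hyz
    exact (limitRel_mk hw).2 ⟨k, hi, hj, (hw _ _ _ _ _ h).trans_le h'⟩
  zero := by
    obtain ⟨i⟩ := ‹Nonempty J›
    exact ⟨i, 0, 0, (OrderedLimit.mk_zero i).symm, (OrderedLimit.mk_zero i).symm,
      fun _ _ _ _ _ => ⟨0, IsBotZeroClass.isBot_zero _⟩⟩
  add := by
    rintro _ _ _ _ ⟨i, a, b, rfl, rfl, h⟩ ⟨j, c, d, rfl, rfl, h'⟩
    obtain ⟨k, hi, hj⟩ := exists_ge_ge i j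
    refine ⟨k, f i k hi a + f j k hj c, f i k hi b + f j k hj d, ?_, ?_,
      (hS k).o3 _ _ _ _ (hw _ _ _ _ _ h) (hw _ _ _ _ _ h')⟩ <;>
    rw [OrderedLimit.mk_add, OrderedLimit.mk_map, OrderedLimit.mk_map]
  exists_seq x := by
    obtain ⟨i, a, rfl⟩ := x.exists_eq_mk
    obtain ⟨z, hz, hzz, hza, hlub⟩ := (hS i).exists_seq a
    refine ⟨fun n => .mk f i (z n), fun n => ⟨i, _, _, rfl, rfl, hzz n⟩,
      fun n => ⟨i, _, _, rfl, rfl, hza n⟩, fun y hy => ?_⟩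
    obtain ⟨j, b, rfl⟩ := y.exists_eq_mk
    obtain ⟨k, hj, hi, h⟩ := (limitRel_mk hw).1 hy
    obtain ⟨n, hn⟩ := h _ (fun _ _ h => (f i k hi).monotone' (hz h)) _
      (hl i k hi z hz a hlub) le_rfl
    exact ⟨n, OrderedLimit.mk_le_mk.2 ⟨k, hj, hi, hn⟩⟩
  exists_add := by
    rintro x y z h
    obtain ⟨i, a, rfl⟩ := y.exists_eq_mk
    obtain ⟨j, b, rfl⟩ := z.exists_eq_mk
    obtain ⟨l, c, rfl⟩ := x.exists_eq_mk
    obtain ⟨k, hi, hj⟩ := exists_ge_ge i j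
    rw [← OrderedLimit.mk_map hi, ← OrderedLimit.mk_map hj, ← OrderedLimit.mk_add,
      limitRel_mk hw] at h
    obtain ⟨m, hl', hk, h⟩ := h
    rw [map_add, DirectedSystem.map_map', DirectedSystem.map_map'] at h
    obtain ⟨v, hv, -, hva, hvlub⟩ := (hS m).exists_seq (f i m (hi.trans hk) a)
    obtain ⟨w, hw', -, hwb, hwlub⟩ := (hS m).exists_seq (f j m (hj.trans hk) b)
    obtain ⟨n, hn⟩ := h _ (fun _ _ h => add_le_add (hv h) (hw' h)) _
      ((hS m).o4 v w hv hw' _ _ hvlub hwlub) le_rfl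
    refine ⟨.mk f m (v n), .mk f m (w n), (limitRel_mk hw).2 ⟨m, le_rfl, hi.trans hk, ?_⟩,
      (limitRel_mk hw).2 ⟨m, le_rfl, hj.trans hk, ?_⟩, ?_⟩
    · rw [DirectedSystem.map_self' f]
      exact hva n
    · rw [DirectedSystem.map_self' f]
      exact hwb n
    · rw [← OrderedLimit.mk_add, OrderedLimit.mk_le_mk]
      exact ⟨m, hl', le_rfl, by rwa [DirectedSystem.map_self' f]⟩

end CuLimit

/-- Colimits of positive Cuntz semigroups exist. -/
theorem exists_isCuLimit {J : Type u} [Preorder J] [IsDirectedOrder J] [Nonempty J] {S : J → Type u}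
    [∀ i, PartialOrder (S i)] [∀ i, AddCommMonoid (S i)] [∀ i, IsOrderedAddMonoid (S i)]
    [∀ i, IsBotZeroClass (S i)] (f : ∀ ⦃i j : J⦄, i ≤ j → CuHom (S i) (S j))
    (hf : IsSystem fun _ _ h => f h) (hS : ∀ i, CuAxioms (S i)) :
    ∃ (A : Type u) (_ : PartialOrder A) (_ : AddCommMonoid A) (_ : IsOrderedAddMonoid A)
      (_ : IsBotZeroClass A) (α : ∀ i, CuHom (S i) A), CuAxioms A ∧ IsCuLimit f α := by
  let g : ∀ i j : J, i ≤ j → S i →+o S j := fun i j h => (f h).toOrderAddMonoidHom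
  have hg : DirectedSystem S (g · · ·) :=
    { map_self := fun i a => hf.id i a
      map_map := fun _ _ _ h h' a => hf.comp h h' a }
  have hw : ∀ i j h, ∀ a b : S i, WayBelow a b → WayBelow (g i j h a) (g i j h b) :=
    fun i j h a b hab => (f h).wayBelow hab
  have hR : IsAuxiliary (LimitRel g) :=
    isAuxiliary_limitRel hS hw fun i j h z hz b hb => (f h).isLUB hz hb
  let α : ∀ i, CuHom (S i) (RoundIdeal (LimitRel g)) := fun i =>
    { toFun := fun a => .below _ (.mk g i a)
      map_zero' := by rw [OrderedLimit.mk_zero]; rfl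
      map_add' := fun a b => by rw [OrderedLimit.mk_add, RoundIdeal.below_add]
      monotone' := fun a b h => RoundIdeal.below_mono ((OrderedLimit.isDirectLimit g).mono i h)
      map_wayBelow := fun a b h => RoundIdeal.below_wayBelow ⟨i, a, b, rfl, rfl, h⟩
      map_isLUB := fun z hz b hb => by
        refine (RoundIdeal.isLUB_iff fun n m h =>
          RoundIdeal.below_mono ((OrderedLimit.isDirectLimit g).mono i (hz h))).2
            fun x => ⟨fun hx => ?_, ?_⟩
        · obtain ⟨j, c, rfl⟩ := x.exists_eq_mk
          obtain ⟨k, hj, hi, h⟩ := (limitRel_mk hw).1 hx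
          obtain ⟨d, hd, hd'⟩ := (hS k).exists_between h
          obtain ⟨n, hn⟩ := hd' _ (fun _ _ h => (f hi).mono (hz h)) _ ((f hi).isLUB hz hb) le_rfl
          exact ⟨n, (limitRel_mk hw).2 ⟨k, hj, hi, hd.trans_le hn⟩⟩
        · rintro ⟨n, hn⟩
          exact RoundIdeal.below_mono ((OrderedLimit.isDirectLimit g).mono i (hb.1 ⟨n, rfl⟩)) hn }
  refine ⟨RoundIdeal (LimitRel g), inferInstance, inferInstance, inferInstance, inferInstance, α,
    RoundIdeal.cuAxioms, ?_, ?_, ?_⟩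
  · intro i j h a
    exact congrArg (RoundIdeal.below _) (OrderedLimit.mk_map (f := g) h a)
  · intro I K h
    obtain ⟨x, hx, hI⟩ := RoundIdeal.wayBelow_iff.1 h
    obtain ⟨y, hy, hxy⟩ := RoundIdeal.exists_rel hx
    obtain ⟨i, a, rfl⟩ := y.exists_eq_mk
    exact ⟨i, a, fun z hz => hR.of_le (hI z hz) hxy, RoundIdeal.below_le hy⟩
  · intro i j a' a b h h'
    have : LimitRel g (.mk g i a') (.mk g j b) :=
      h' (show LimitRel g (.mk g i a') (.mk g i a) from ⟨i, a', a, rfl, rfl, h⟩)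
    obtain ⟨k, hi, hj, hk⟩ := (limitRel_mk hw).1 this
    exact ⟨k, hi, hj, hk.le⟩

/-! ### Webs of systems of groups -/

namespace Web

section

variable {S : Type u} [PartialOrder S] {G : S ⥤ AddCommGrpCat.{u}}

theorem tr_eq_of_le {x y : Web G} (h : x ≤ y) {t : S} (ht : y.base ≤ t) :
    tr G (h.1.trans ht) x.val = tr G ht y.val := by
  rw [← h.2, tr_tr]

/-- An element of the web above `z` is determined by its base point. -/
theorem eq_of_le_of_le {x y z : Web G} (hx : z ≤ x) (hy : z ≤ y) (h : x.base = y.base) : x = y :=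
  ext' h ((tr_eq_of_le hx h.le).symm.trans hy.2)

theorem le_of_le_of_le {x y z : Web G} (hx : z ≤ x) (hy : z ≤ y) (h : x.base ≤ y.base) : x ≤ y :=
  ⟨h, (tr_eq_of_le hx h).symm.trans hy.2⟩

/-- The element over `t` that lies above `x`. -/
def push (x : Web G) {t : S} (h : x.base ≤ t) : Web G := ⟨t, tr G h x.val⟩

theorem le_push (x : Web G) {t : S} (h : x.base ≤ t) : x ≤ x.push h := ⟨h, rfl⟩

end

end Web

section System

variable {J : Type u} [Preorder J] (F : J ⥤ PoSGp.{u})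

/-- The transition maps of the base spaces of a system `F`. -/
def baseMap ⦃i j : J⦄ (h : i ≤ j) : (F.obj i).base → (F.obj j).base := (F.map (homOfLE h)).base

/-- The transition maps of the webbed system. -/
def webMap ⦃i j : J⦄ (h : i ≤ j) : Web (F.obj i).fib → Web (F.obj j).fib :=
  Web.map (F.map (homOfLE h)).fib

theorem isSystem_baseMap : IsSystem (baseMap F) where
  mono _ _ h := (F.map (homOfLE h)).base.monotone
  id i a := congrArg (fun g : F.obj i ⟶ F.obj i => g.base a) (F.map_id i)
  comp i _ k h h' a := congrArg (fun g : F.obj i ⟶ F.obj k => g.base a)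
    (F.map_comp (homOfLE h) (homOfLE h')).symm

theorem isSystem_webMap : IsSystem (webMap F) where
  mono _ _ _ := Web.map_mono _
  id i x := congrArg (fun g : F.obj i ⟶ F.obj i => Web.map g.fib x) (F.map_id i)
  comp i _ k h h' x := congrArg (fun g : F.obj i ⟶ F.obj k => Web.map g.fib x)
    (F.map_comp (homOfLE h) (homOfLE h')).symm

/-- The disjoint union of the base spaces of a system. -/
structure Elt where
  /-- The stage. -/
  idx : J
  /-- The point of the base space at that stage. -/
  pt : (F.obj idx).base

/-- `(i, a) ≤ (j, b)` when `i ≤ j` and the image of `a` at stage `j` lies below `b`. -/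
instance : Preorder (Elt F) where
  le x y := ∃ h : x.idx ≤ y.idx, baseMap F h x.pt ≤ y.pt
  le_refl x := ⟨le_rfl, ((isSystem_baseMap F).id _ _).le⟩
  le_trans x y z := by
    rintro ⟨h, hxy⟩ ⟨h', hyz⟩
    refine ⟨h.trans h', ?_⟩
    rw [← (isSystem_baseMap F).comp h h']
    exact ((isSystem_baseMap F).mono h' hxy).trans hyz

/-- The groups of a system, as one functor on the disjoint union of the base spaces. -/
def fibres : Elt F ⥤ AddCommGrpCat.{u} where
  obj x := (F.obj x.idx).fib.obj x.pt
  map {x y} f := (F.map (homOfLE (leOfHom f).1)).fib.app x.pt ≫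
    (F.obj y.idx).fib.map (homOfLE (leOfHom f).2)
  map_id x := by
    ext g
    have h := (isSystem_webMap F).id x.idx ⟨x.pt, g⟩
    exact (Web.tr_eq_of_le h.le le_rfl).trans (tr_refl _ _ _)
  map_comp {x y z} f f' := by
    ext g
    obtain ⟨h, hxy⟩ := leOfHom f
    obtain ⟨h', hyz⟩ := leOfHom f'
    have e := (isSystem_webMap F).comp h h' ⟨x.pt, g⟩
    have l := (isSystem_webMap F).mono h' ((webMap F h ⟨x.pt, g⟩).le_push hxy)
    rw [e] at l
    exact Web.tr_eq_of_le l hyz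

variable {F}

theorem fibres_tr {i j : J} {x : Web (F.obj i).fib} {y : Web (F.obj j).fib} {h : i ≤ j}
    (hxy : webMap F h x ≤ y) :
    tr (fibres F) (s := ⟨i, x.base⟩) (t := ⟨j, y.base⟩) ⟨h, hxy.1⟩ x.val = y.val :=
  hxy.2

end System

/-! ### The limit functor and its germs -/

section

variable {D : Type u} [Category.{u} D] (K : D ⥤ AddCommGrpCat.{u})

theorem ι_desc_hom (c : Cocone K) {j : D} (g : K.obj j) :
    (colimit.desc K c).hom ((colimit.ι K j).hom g) = (c.ι.app j).hom g :=
  congrArg (fun f : K.obj j ⟶ c.pt => f.hom g) (colimit.ι_desc c j)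

theorem ι_map_hom {i j : D} (f : i ⟶ j) (g : K.obj i) :
    (colimit.ι K j).hom ((K.map f).hom g) = (colimit.ι K i).hom g :=
  congrArg (fun f : K.obj i ⟶ colimit K => f.hom g) (colimit.w K f)

end

/-- The data from which the groups of a colimit are built, over a compatible family `α` from the
base spaces of the system `F` to `S`. For `s` in `S`, the group over `s` will be the filtered
colimit of the groups `G_i(a)` over the pairs `(i, a)` in `D s`; the relation `L` singles out,
below a point `a` of a base space, points `a'` such that `(i, a')` belongs to `D (α i a)` and
`G_i(a)` is exhausted by the groups `G_i(a')`. -/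
structure GermFrame {J : Type u} [Preorder J] (F : J ⥤ PoSGp.{u}) (S : Type u)
    [PartialOrder S] where
  /-- The maps from the base spaces to `S`. -/
  α : ∀ i, (F.obj i).base → S
  compat : IsCompatible (baseMap F) α
  /-- The pairs that approximate an element of `S`. -/
  D : S → Set (Elt F)
  /-- The local approximation relation. -/
  L : ∀ i, (F.obj i).base → (F.obj i).base → Prop
  le_of_mem : ∀ {s i a}, ⟨i, a⟩ ∈ D s → α i a ≤ s
  mono : Monotone D
  directed : ∀ s, DirectedOn (· ≤ ·) (D s)
  nonempty : ∀ s, (D s).Nonempty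
  map_mem : ∀ {s i j} (h : i ≤ j) {a}, ⟨i, a⟩ ∈ D s → ⟨j, baseMap F h a⟩ ∈ D s
  le_of_mem_self : ∀ {i j a b}, ⟨i, a⟩ ∈ D (α j b) →
    ∃ k, ∃ (hi : i ≤ k) (hj : j ≤ k), baseMap F hi a ≤ baseMap F hj b
  mem_of_L : ∀ {i a' a}, L i a' a → ⟨i, a'⟩ ∈ D (α i a)
  exists_L : ∀ {i} (x : Web (F.obj i).fib), ∃ x' ≤ x, L i x'.base x.base
  directed_L : ∀ {i} {x x' x'' : Web (F.obj i).fib}, x' ≤ x → x'' ≤ x → L i x'.base x.base →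
    L i x''.base x.base → ∃ z ≤ x, L i z.base x.base ∧ x' ≤ z ∧ x'' ≤ z
  L_trans : ∀ {i a' a b}, L i a' a → a ≤ b → L i a' b
  L_map : ∀ {i j} (h : i ≤ j) {a' a}, L i a' a → L j (baseMap F h a') (baseMap F h a)

namespace GermFrame

variable {J : Type u} [Preorder J] {F : J ⥤ PoSGp.{u}} {S : Type u} [PartialOrder S]
  (X : GermFrame F S)

instance (s : S) : Nonempty (X.D s) := (X.nonempty s).to_subtype

instance (s : S) : IsDirectedOrder (X.D s) where
  directed x y := by
    obtain ⟨z, hz, h, h'⟩ := X.directed s x x.2 y y.2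
    exact ⟨⟨z, hz⟩, h, h'⟩

/-- The groups over the pairs that approximate `s`. -/
def diagram (s : S) : X.D s ⥤ AddCommGrpCat.{u} :=
  (Subtype.mono_coe (· ∈ X.D s)).functor ⋙ fibres F

/-- For `s ≤ t`, the groups over the pairs that approximate `s` map to the colimit over `t`. -/
noncomputable def cocone {s t : S} (h : s ≤ t) : Cocone (X.diagram s) where
  pt := colimit (X.diagram t)
  ι :=
    { app := fun e => colimit.ι (X.diagram t) ⟨e.1, X.mono h e.2⟩
      naturality := fun e e' g => (colimit.w (X.diagram t)
        (homOfLE (leOfHom g) : (⟨e.1, X.mono h e.2⟩ : X.D t) ⟶ ⟨e'.1, X.mono h e'.2⟩)).trans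
          (Category.comp_id _).symm }

/-- The limit functor: the group over `s` is the filtered colimit of the groups over the pairs that
approximate `s`. -/
noncomputable def fib : S ⥤ AddCommGrpCat.{u} where
  obj s := colimit (X.diagram s)
  map {s t} f := colimit.desc (X.diagram s) (X.cocone (leOfHom f))
  map_id s := colimit.hom_ext fun e => by
    rw [colimit.ι_desc]
    exact (Category.comp_id _).symm
  map_comp f g := colimit.hom_ext fun e =>
    (colimit.ι_desc _ _).trans ((colimit.ι_desc_assoc (X.cocone (leOfHom f)) e
      (colimit.desc _ (X.cocone (leOfHom g)))).trans (colimit.ι_desc _ _)).symm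

/-- The class over `s` of an element `x` of the web of some stage. -/
noncomputable def germ (s : S) {i : J} (x : Web (F.obj i).fib) (hx : ⟨i, x.base⟩ ∈ X.D s) :
    Web X.fib :=
  ⟨s, (colimit.ι (X.diagram s) ⟨⟨i, x.base⟩, hx⟩).hom x.val⟩

variable {X}

theorem germ_le {s t : S} {i : J} {x : Web (F.obj i).fib} (hx : ⟨i, x.base⟩ ∈ X.D s) (h : s ≤ t) :
    X.germ s x hx ≤ X.germ t x (X.mono h hx) :=
  ⟨h, ι_desc_hom (X.diagram s) (X.cocone h) _⟩

theorem germ_eq {s : S} {i j : J} {x : Web (F.obj i).fib} {y : Web (F.obj j).fib}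
    (hx : ⟨i, x.base⟩ ∈ X.D s) (hy : ⟨j, y.base⟩ ∈ X.D s) {h : i ≤ j} (hxy : webMap F h x ≤ y) :
    X.germ s x hx = X.germ s y hy := by
  have e := ι_map_hom (X.diagram s)
    (homOfLE ⟨h, hxy.1⟩ : (⟨⟨i, x.base⟩, hx⟩ : X.D s) ⟶ ⟨⟨j, y.base⟩, hy⟩) x.val
  have e' := congrArg (colimit.ι (X.diagram s) ⟨⟨j, y.base⟩, hy⟩).hom (fibres_tr hxy)
  exact congrArg (Web.mk s) (e.symm.trans e')

theorem germ_eq_of_le {s : S} {i : J} {x y : Web (F.obj i).fib}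
    (hx : ⟨i, x.base⟩ ∈ X.D s) (hy : ⟨i, y.base⟩ ∈ X.D s) (hxy : x ≤ y) :
    X.germ s x hx = X.germ s y hy :=
  germ_eq hx hy (h := le_rfl) (by rwa [(isSystem_webMap F).id])

theorem exists_germ (y : Web X.fib) : ∃ (i : J) (x : Web (F.obj i).fib)
    (hx : ⟨i, x.base⟩ ∈ X.D y.base), X.germ y.base x hx = y := by
  have := preservesSmallestFilteredColimits_of_preservesFilteredColimits
    (forget AddCommGrpCat.{u})
  obtain ⟨⟨⟨i, a⟩, he⟩, g, hg⟩ :=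
    Concrete.isColimit_exists_rep _ (colimit.isColimit (X.diagram y.base)) y.val
  exact ⟨i, ⟨a, g⟩, he, congrArg (Web.mk y.base) hg⟩

/-- Two germs over `s` agree when they do so at some stage. -/
theorem exists_of_germ_eq {s : S} {i j : J} {x : Web (F.obj i).fib} {y : Web (F.obj j).fib}
    {hx : ⟨i, x.base⟩ ∈ X.D s} {hy : ⟨j, y.base⟩ ∈ X.D s} (h : X.germ s x hx = X.germ s y hy) :
    ∃ (k : J) (hi : i ≤ k) (hj : j ≤ k) (z : Web (F.obj k).fib), ⟨k, z.base⟩ ∈ X.D s ∧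
      webMap F hi x ≤ z ∧ webMap F hj y ≤ z := by
  have := preservesSmallestFilteredColimits_of_preservesFilteredColimits
    (forget AddCommGrpCat.{u})
  have h' : (colimit.ι (X.diagram s) ⟨⟨i, x.base⟩, hx⟩).hom x.val =
      (colimit.ι (X.diagram s) ⟨⟨j, y.base⟩, hy⟩).hom y.val := by
    exact eq_of_heq (Web.mk.inj h).2
  obtain ⟨⟨⟨k, c⟩, he⟩, f, f', hk⟩ := Concrete.colimit_exists_of_rep_eq.{u}
    (X.diagram s) (i := ⟨⟨i, x.base⟩, hx⟩) (j := ⟨⟨j, y.base⟩, hy⟩) x.val y.val h'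
  obtain ⟨hi, hi'⟩ := leOfHom f
  obtain ⟨hj, hj'⟩ := leOfHom f'
  exact ⟨k, hi, hj, (webMap F hi x).push hi', he, Web.le_push _ _, hj', hk.symm⟩

variable (X) in
/-- The map from the web of the `i`-th stage to the web of the limit functor. -/
noncomputable def webOf (i : J) (x : Web (F.obj i).fib) : Web X.fib :=
  X.germ (X.α i x.base) (X.exists_L x).choose (X.mem_of_L (X.exists_L x).choose_spec.2)

theorem webOf_eq {i : J} {x x' : Web (F.obj i).fib} (h : x' ≤ x) (hL : X.L i x'.base x.base) :
    X.webOf i x = X.germ (X.α i x.base) x' (X.mem_of_L hL) := by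
  obtain ⟨z, -, hL', hz, hz'⟩ := X.directed_L h (X.exists_L x).choose_spec.1 hL
    (X.exists_L x).choose_spec.2
  rw [webOf, germ_eq_of_le _ (X.mem_of_L hL') hz', germ_eq_of_le _ (X.mem_of_L hL') hz]

theorem webOf_mono (i : J) : Monotone (X.webOf i) := by
  intro x y h
  obtain ⟨x', hx, hL⟩ := X.exists_L x
  rw [webOf_eq hx hL, webOf_eq (hx.trans h) (X.L_trans hL h.1)]
  exact germ_le _ (X.compat.mono i h.1)

theorem webOf_webMap {i j : J} (h : i ≤ j) (x : Web (F.obj i).fib) :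
    X.webOf j (webMap F h x) = X.webOf i x := by
  obtain ⟨x', hx, hL⟩ := X.exists_L x
  rw [webOf_eq hx hL, webOf_eq ((isSystem_webMap F).mono h hx) (X.L_map h hL)]
  refine Web.eq_of_le_of_le le_rfl ?_ (X.compat.comp h x.base)
  rw [germ_eq (X.mem_of_L hL) (X.map_mem h (X.mem_of_L hL)) (h := h) le_rfl]
  exact germ_le _ (X.compat.comp h x.base).le

theorem isCompatible_webOf : IsCompatible (webMap F) X.webOf where
  mono := webOf_mono
  comp _ _ := webOf_webMap

theorem webOf_le_germ {s : S} {i : J} {x : Web (F.obj i).fib} (hx : ⟨i, x.base⟩ ∈ X.D s) :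
    X.webOf i x ≤ X.germ s x hx := by
  obtain ⟨x', h, hL⟩ := X.exists_L x
  rw [webOf_eq h hL, ← germ_eq_of_le (X.mono (X.le_of_mem hx) (X.mem_of_L hL)) hx h]
  exact germ_le _ (X.le_of_mem hx)

theorem germ_eq_of_webOf_le {s : S} {i : J} {x : Web (F.obj i).fib} (hx : ⟨i, x.base⟩ ∈ X.D s)
    {y : Web X.fib} (h : X.webOf i x ≤ y) (hy : y.base = s) : X.germ s x hx = y :=
  Web.eq_of_le_of_le (webOf_le_germ hx) h hy.symm

variable (X) in
/-- The map `webOf` on the group `G_i(a)`. -/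
noncomputable def fibMap (i : J) (a : (F.obj i).base) (g : (F.obj i).fib.obj a) :
    X.fib.obj (X.α i a) := (X.webOf i ⟨a, g⟩).val

theorem fibMap_eq {i : J} {a : (F.obj i).base} {g : (F.obj i).fib.obj a} {x' : Web (F.obj i).fib}
    (h : x' ≤ ⟨a, g⟩) (hL : X.L i x'.base a) : X.fibMap i a g =
      (colimit.ι (X.diagram (X.α i a)) ⟨⟨i, x'.base⟩, X.mem_of_L hL⟩).hom x'.val :=
  eq_of_heq (Web.mk.inj (webOf_eq h hL)).2

theorem fibMap_add (i : J) (a : (F.obj i).base) (g h : (F.obj i).fib.obj a) :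
    X.fibMap i a (g + h) = X.fibMap i a g + X.fibMap i a h := by
  obtain ⟨x, hx, hL⟩ := X.exists_L ⟨a, g⟩
  obtain ⟨y, hy, hL'⟩ := X.exists_L ⟨a, h⟩
  -- The zero sections over the base points of `x` and `y` provide a common point above both.
  obtain ⟨z, hz, hL'', ⟨hxz, -⟩, ⟨hyz, -⟩⟩ := X.directed_L (x := ⟨a, 0⟩) (x' := ⟨x.base, 0⟩)
    (x'' := ⟨y.base, 0⟩) ⟨hx.1, map_zero _⟩ ⟨hy.1, map_zero _⟩ hL hL'
  have h1 := Web.le_of_le_of_le (x.le_push hxz) hx hz.1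
  have h2 := Web.le_of_le_of_le (y.le_push hyz) hy hz.1
  rw [fibMap_eq h1 hL'', fibMap_eq h2 hL'', fibMap_eq (g := g + h)
    (x' := ⟨z.base, tr _ hxz x.val + tr _ hyz y.val⟩)
    ⟨hz.1, (map_add _ _ _).trans (congrArg₂ _ h1.2 h2.2)⟩ hL'']
  exact map_add (colimit.ι (X.diagram (X.α i a)) ⟨⟨i, z.base⟩, X.mem_of_L hL''⟩).hom _ _

variable (X) in
/-- The natural transformation from the functor of the `i`-th stage to the limit functor. -/
noncomputable def fibOf (i : J) : (F.obj i).fib ⟶ (X.compat.mono i).functor ⋙ X.fib where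
  app a := AddCommGrpCat.ofHom (AddMonoidHom.mk' (X.fibMap i a) (fibMap_add i a))
  naturality a b f := by
    ext g
    exact (webOf_mono (X := X) i (Web.le_push ⟨a, g⟩ (leOfHom f))).2.symm

/-- The universal property of the limit functor: for a compatible family of natural transformations
from the stages, there is a natural transformation from the limit functor, over any map `γ` of the
base spaces. -/
theorem exists_desc {T : Type u} [PartialOrder T] {H : T ⥤ AddCommGrpCat.{u}}
    {τ : ∀ i, (F.obj i).base → T} {hτ : ∀ i, Monotone (τ i)}
    (ν : ∀ i, (F.obj i).fib ⟶ (hτ i).functor ⋙ H)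
    (hν : ∀ {i j} (h : i ≤ j) x, Web.map (ν j) (webMap F h x) = Web.map (ν i) x)
    {γ : S → T} (hγ : Monotone γ) (hγα : ∀ i a, γ (X.α i a) = τ i a) :
    ∃ θ : X.fib ⟶ hγ.functor ⋙ H, ∀ i x, Web.map θ (X.webOf i x) = Web.map (ν i) x := by
  have hle : ∀ {s i a}, ⟨i, a⟩ ∈ X.D s → τ i a ≤ γ s := fun h =>
    (hγα _ _).ge.trans (hγ (X.le_of_mem h))
  let c : ∀ s, Cocone (X.diagram s) := fun s =>
    { pt := H.obj (γ s)
      ι :=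
        { app := fun e => (ν e.1.idx).app e.1.pt ≫ H.map (homOfLE (hle e.2))
          naturality := fun e e' f => by
            ext g
            obtain ⟨h, h'⟩ := leOfHom f
            have l := Web.map_mono (ν e'.1.idx) ((webMap F h ⟨e.1.pt, g⟩).le_push h')
            rw [hν h] at l
            exact (Web.tr_eq_of_le l (hle e'.2)).symm } }
  let θ : X.fib ⟶ hγ.functor ⋙ H :=
    { app := fun s => colimit.desc (X.diagram s) (c s)
      naturality := fun s t f => colimit.hom_ext fun e => by
        refine (colimit.ι_desc_assoc (X.cocone (leOfHom f)) e (colimit.desc _ (c t))).trans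
          ((colimit.ι_desc (c t) _).trans ?_)
        refine Eq.trans ?_ (colimit.ι_desc_assoc (c s) e (H.map (homOfLE (hγ (leOfHom f))))).symm
        refine Eq.trans ?_ (Category.assoc _ _ _).symm
        exact congrArg ((ν e.1.idx).app e.1.pt ≫ ·)
          (H.map_comp (homOfLE (hle e.2)) (homOfLE (hγ (leOfHom f)))) }
  have hθ : ∀ {s i} (x : Web (F.obj i).fib) (hx : ⟨i, x.base⟩ ∈ X.D s),
      Web.map θ (X.germ s x hx) = (Web.map (ν i) x).push (hle hx) := fun {s i} x hx =>
    congrArg (Web.mk (G := H) (γ s)) (ι_desc_hom (X.diagram s) (c s) _)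
  refine ⟨θ, fun i x => ?_⟩
  obtain ⟨x', h, hL⟩ := X.exists_L x
  rw [webOf_eq h hL, hθ]
  exact Web.eq_of_le_of_le (Web.le_push _ _) (Web.map_mono _ h) (hγα _ _)

/-- Order-preserving maps on the web of the limit functor are determined by what they do on the
webs of the stages and on the base space. -/
theorem webOf_ext {T : Type u} [PartialOrder T] {H : T ⥤ AddCommGrpCat.{u}}
    {Θ Θ' : Web X.fib → Web H} (hΘ : Monotone Θ) (hΘ' : Monotone Θ')
    (hb : ∀ y, (Θ y).base = (Θ' y).base) (h : ∀ i x, Θ (X.webOf i x) = Θ' (X.webOf i x)) :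
    Θ = Θ' := by
  funext y
  obtain ⟨i, x, hx, hy⟩ := exists_germ y
  have hle : X.webOf i x ≤ y := hy ▸ webOf_le_germ hx
  exact Web.eq_of_le_of_le (hΘ hle) ((h i x).trans_le (hΘ' hle)) (hb y)

/-! ### The web of the limit functor as a limit of webs -/

/-- Every element over a point below `α i a` lies below the image of an element over the image of
`a` at a later stage. -/
theorem exists_le_webOf [IsDirectedOrder J] {y : Web X.fib} {i : J} {a : (F.obj i).base}
    (h : y.base ≤ X.α i a) :
    ∃ (k : J) (hi : i ≤ k) (x : Web (F.obj k).fib), x.base = baseMap F hi a ∧ y ≤ X.webOf k x := by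
  obtain ⟨j, x, hx, hy⟩ := exists_germ y
  have hxy : X.webOf j x ≤ y := hy ▸ webOf_le_germ hx
  obtain ⟨k, hj, hi, hk⟩ := X.le_of_mem_self (X.mono h hx)
  have e : X.α k (baseMap F hi a) = X.α i a := X.compat.comp hi a
  have hle : X.webOf j x ≤ X.webOf k ((webMap F hj x).push hk) := by
    rw [← webOf_webMap hj]
    exact webOf_mono k (Web.le_push _ _)
  exact ⟨k, hi, (webMap F hj x).push hk, rfl,
    Web.le_of_le_of_le hxy hle (h.trans_eq e.symm)⟩

/-- An inequality between images of elements of the stages holds at some stage already, if the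
left-hand one approximates the right-hand one. -/
theorem le_of_webOf_le [IsDirectedOrder J] {i j : J} {x : Web (F.obj i).fib}
    {y : Web (F.obj j).fib} (hx : ⟨i, x.base⟩ ∈ X.D (X.α j y.base))
    (h : X.webOf i x ≤ X.webOf j y) :
    ∃ (k : J) (hi : i ≤ k) (hj : j ≤ k), webMap F hi x ≤ webMap F hj y := by
  obtain ⟨y', hy, hL⟩ := X.exists_L y
  have e := germ_eq_of_webOf_le hx h rfl
  rw [webOf_eq hy hL] at e
  obtain ⟨p, hi, hj, z, hz, hxz, hyz⟩ := exists_of_germ_eq e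
  obtain ⟨k, hp, hj', hk⟩ := X.le_of_mem_self hz
  have hs := isSystem_webMap F
  refine ⟨k, hi.trans hp, hj', ?_⟩
  -- Above the image of `y'` there is only one element over each point, so `z` lies below `y`.
  have h1 : webMap F (hj.trans hp) y' ≤ webMap F hp z := by
    rw [← hs.comp hj hp]
    exact hs.mono hp hyz
  have h2 : webMap F hp z ≤ webMap F hj' y := Web.le_of_le_of_le h1 (hs.mono _ hy) hk
  rw [← hs.comp hi hp]
  exact (hs.mono hp hxz).trans h2

/-- Every element over `α i a` comes from an element over the image of `a` at a later stage. -/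
theorem exists_eq_webOf [IsDirectedOrder J] {y : Web X.fib} {i : J} {a : (F.obj i).base}
    (h : y.base = X.α i a) :
    ∃ (k : J) (hi : i ≤ k) (x : Web (F.obj k).fib), x.base = baseMap F hi a ∧ X.webOf k x = y := by
  obtain ⟨k, hi, x, hx, hy⟩ := exists_le_webOf h.le
  refine ⟨k, hi, x, hx, Web.eq_of_le_of_le hy le_rfl ?_⟩
  rw [h, ← X.compat.comp hi a, ← hx]
  rfl

theorem subsingleton_fib [IsDirectedOrder J] {i : J} {a : (F.obj i).base}
    (h : ∀ k (hi : i ≤ k), Subsingleton ((F.obj k).fib.obj (baseMap F hi a))) :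
    Subsingleton (X.fib.obj (X.α i a)) where
  allEq g g' := by
    obtain ⟨k, hi, x, hx, hy⟩ := exists_eq_webOf (X := X) (y := ⟨X.α i a, g⟩) rfl
    obtain ⟨k', hi', x', hx', hy'⟩ := exists_eq_webOf (X := X) (y := ⟨X.α i a, g'⟩) rfl
    obtain ⟨l, hl, hl'⟩ := exists_ge_ge k k'
    have hs := isSystem_baseMap F
    have hb : baseMap F hl x.base = baseMap F (hi.trans hl) a := by rw [hx, hs.comp]
    have hb' : baseMap F hl' x'.base = baseMap F (hi.trans hl) a := by rw [hx', hs.comp]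
    have e : webMap F hl x = webMap F hl' x' := by
      refine Web.ext' (hb.trans hb'.symm) ?_
      have : Subsingleton ((F.obj l).fib.obj (baseMap F hl' x'.base)) :=
        hb' ▸ h l (hi.trans hl)
      exact this.elim _ _
    have e' : (⟨X.α i a, g⟩ : Web X.fib) = ⟨X.α i a, g'⟩ := by
      rw [← hy, ← hy', ← webOf_webMap hl, e, webOf_webMap]
    exact eq_of_heq (Web.mk.inj e').2

/-- If the pairs that approximate a supremum already approximate one of the terms, then the limit
functor sends suprema of increasing sequences to inductive limits of groups. -/
theorem preservesColimits_fib
    (h : ∀ z : ℕ → S, Monotone z → ∀ b, IsLUB (Set.range z) b → ∀ e ∈ X.D b, ∃ n, e ∈ X.D (z n)) :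
    PreservesColimitsOfShape ℕ X.fib where
  preservesColimit {K} :=
    { preserves := fun {c} hc => by
        have hz : Monotone K.obj := fun n m hnm => leOfHom (K.map (homOfLE hnm))
        have hb : IsLUB (Set.range K.obj) c.pt := by
          refine ⟨?_, fun y hy => leOfHom (hc.desc
            ⟨y, { app := fun n => homOfLE (hy ⟨n, rfl⟩), naturality := fun _ _ _ => rfl }⟩)⟩
          rintro _ ⟨n, rfl⟩
          exact leOfHom (c.ι.app n)
        have := preservesSmallestFilteredColimits_of_preservesFilteredColimits
          (forget AddCommGrpCat.{u})
        have : ReflectsColimitsOfShape ℕ (forget AddCommGrpCat.{u}) :=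
          reflectsColimitsOfShape_of_reflectsIsomorphisms
        refine ⟨isColimitOfReflects (forget AddCommGrpCat.{u})
          (Types.FilteredColimit.isColimitOf _ _ ?_ ?_)⟩
        · intro g
          obtain ⟨i, x, hx, hg⟩ := exists_germ (X := X) ⟨c.pt, g⟩
          obtain ⟨n, hn⟩ := h _ hz _ hb _ hx
          refine ⟨n, (X.germ (K.obj n) x hn).val, ?_⟩
          have := (germ_le hn (leOfHom (c.ι.app n))).2
          exact (eq_of_heq (Web.mk.inj hg).2).symm.trans this.symm
        · intro n m g g' hgg
          obtain ⟨i, x, hx, hg⟩ := exists_germ (X := X) ⟨K.obj n, g⟩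
          obtain ⟨j, y, hy, hg'⟩ := exists_germ (X := X) ⟨K.obj m, g'⟩
          have hn := leOfHom (c.ι.app n)
          have hm := leOfHom (c.ι.app m)
          have e : X.germ c.pt x (X.mono hn hx) = X.germ c.pt y (X.mono hm hy) := by
            have l := germ_le hx hn
            have l' := germ_le hy hm
            rw [hg] at l
            rw [hg'] at l'
            have hgg' : tr X.fib hn g = tr X.fib hm g' := hgg
            exact congrArg (Web.mk c.pt) (l.2.symm.trans (hgg'.trans l'.2))
          obtain ⟨k, hi, hj, z, hz', h1, h2⟩ := exists_of_germ_eq e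
          obtain ⟨p, hp⟩ := h _ hz _ hb _ hz'
          let q := max p (max n m)
          have hnq : n ≤ q := (le_max_left n m).trans (le_max_right _ _)
          have hmq : m ≤ q := (le_max_right n m).trans (le_max_right _ _)
          have hzq := X.mono (hz (le_max_left p (max n m))) hp
          have l := germ_le hx (hz hnq)
          have l' := germ_le hy (hz hmq)
          rw [germ_eq _ hzq h1, hg] at l
          rw [germ_eq _ hzq h2, hg'] at l'
          exact ⟨q, homOfLE hnq, homOfLE hmq, l.2.trans l'.2.symm⟩ }

end GermFrame

/-! ### Reduction to one colimit -/

/-- If one colimit of `F` exists and is preserved by `W`, then every colimit is, and the comparison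
morphisms from the colimits of the image system are isomorphisms. -/
theorem exists_colimit_and_isIso {J C C' : Type*} [Category* J] [Category* C] [Category* C']
    {F : J ⥤ C} {W : C ⥤ C'}
    (h : ∃ c : Cocone F, Nonempty (IsColimit c) ∧ Nonempty (IsColimit (W.mapCocone c))) :
    HasColimit F ∧ ∀ c : Cocone F, IsColimit c → Nonempty (IsColimit (W.mapCocone c)) ∧
      ∀ (d : Cocone (F ⋙ W)) (hd : IsColimit d), IsIso (hd.desc (W.mapCocone c)) := by
  obtain ⟨c₀, ⟨h₀⟩, ⟨hW⟩⟩ := h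
  have := preservesColimit_of_preserves_colimit_cocone h₀ hW
  exact ⟨⟨⟨c₀, h₀⟩⟩, fun c hc => ⟨⟨isColimitOfPreserves W hc⟩, fun d hd =>
    (hd.coconePointUniqueUpToIso (isColimitOfPreserves W hc)).isIso_hom⟩⟩

theorem embedding_and_surjective {X Y : Type*} [Preorder X] [Preorder Y] {f : X → Y} {g : Y → X}
    (hf : Monotone f) (hg : Monotone g) (hgf : ∀ x, g (f x) = x) (hfg : ∀ y, f (g y) = y) :
    (∀ x y, f x ≤ f y ↔ x ≤ y) ∧ Function.Surjective f :=
  ⟨fun x y => ⟨fun h => by simpa only [hgf] using hg h, fun h => hf h⟩, fun y => ⟨g y, hfg y⟩⟩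

theorem partOrd_embedding {X Y : PartOrd.{u}} (f : X ⟶ Y) [IsIso f] :
    (∀ x y : ToType X, f x ≤ f y ↔ x ≤ y) ∧ Function.Surjective f :=
  embedding_and_surjective f.hom.monotone (inv f).hom.monotone
    (fun x => congrArg (fun k : X ⟶ X => k x) (IsIso.hom_inv_id f))
    (fun y => congrArg (fun k : Y ⟶ Y => k y) (IsIso.inv_hom_id f))

theorem omStar_embedding {X Y : OMStar.{u}} (f : X ⟶ Y) [IsIso f] :
    (∀ x y : ToType X, f x ≤ f y ↔ x ≤ y) ∧ Function.Surjective f :=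
  embedding_and_surjective f.hom.hom.monotone' (inv f).hom.hom.monotone'
    (fun x => congrArg (fun k : X ⟶ X => k x) (IsIso.hom_inv_id f))
    (fun y => congrArg (fun k : Y ⟶ Y => k y) (IsIso.inv_hom_id f))

theorem cuStar_embedding {X Y : CuStar.{u}} (f : X ⟶ Y) [IsIso f] :
    (∀ x y : ToType X, f x ≤ f y ↔ x ≤ y) ∧ Function.Surjective f :=
  embedding_and_surjective f.hom.mono (inv f).hom.mono
    (fun x => congrArg (fun k : X ⟶ X => k x) (IsIso.hom_inv_id f))
    (fun y => congrArg (fun k : Y ⟶ Y => k y) (IsIso.inv_hom_id f))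

/-- A cocone is a colimit if every other cocone factors through it in exactly one way. -/
theorem nonempty_isColimit {J C : Type*} [Category* J] [Category* C] {F : J ⥤ C} {c : Cocone F}
    (h : ∀ t : Cocone F, ∃ d : c.pt ⟶ t.pt, ∀ j, c.ι.app j ≫ d = t.ι.app j)
    (h' : ∀ (Z : C) (d d' : c.pt ⟶ Z), (∀ j, c.ι.app j ≫ d = c.ι.app j ≫ d') → d = d') :
    Nonempty (IsColimit c) := by
  choose d hd using h
  exact ⟨⟨d, hd, fun t m hm => h' _ _ _ fun j => (hm j).trans (hd t j).symm⟩⟩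

/-! ### Posets -/

theorem PoSGp.hom_ext {X Y : PoSGp.{u}} {f g : X ⟶ Y}
    (h : ∀ x, Web.map f.fib x = Web.map g.fib x) : f = g := by
  obtain ⟨α, η⟩ := f
  obtain ⟨β, ν⟩ := g
  obtain rfl : α = β := OrderHom.ext _ _ (funext fun s => congrArg Web.base (h ⟨s, 0⟩))
  refine PoSGp.Hom.ext' rfl fun s => heq_of_eq ?_
  ext g
  exact eq_of_heq (Web.mk.inj (h ⟨s, g⟩)).2

section DirectLimitFrame

variable {J : Type u} [Preorder J] [IsDirectedOrder J] {F : J ⥤ PoSGp.{u}}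
  {A : Type u} [PartialOrder A] {α : ∀ i, (F.obj i).base → A}

/-- Over a direct limit of posets, `s` is approximated by all pairs `(i, a)` with `α i a ≤ s`. -/
def IsDirectLimit.frame (hα : IsDirectLimit (baseMap F) α) : GermFrame F A where
  α := α
  compat := hα.toIsCompatible
  D s := {e | α e.idx e.pt ≤ s}
  L _ a' a := a' ≤ a
  le_of_mem h := h
  mono _ _ h _ he := he.trans h
  directed := by
    rintro s ⟨i, a⟩ ha ⟨j, b⟩ hb
    obtain ⟨l, c, rfl⟩ := hα.surj s
    obtain ⟨p, hi, hp, h⟩ := hα.le_of_le a c ha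
    obtain ⟨q, hj, hq, h'⟩ := hα.le_of_le b c hb
    obtain ⟨k, hpk, hqk⟩ := exists_ge_ge p q
    have hs := isSystem_baseMap F
    refine ⟨⟨k, baseMap F (hp.trans hpk) c⟩, (hα.comp _ _).le, ⟨hi.trans hpk, ?_⟩,
      ⟨hj.trans hqk, ?_⟩⟩
    · rw [← hs.comp hi hpk, ← hs.comp hp hpk]
      exact hs.mono hpk h
    · change _ ≤ baseMap F (hq.trans hqk) c
      rw [← hs.comp hj hqk, ← hs.comp hq hqk]
      exact hs.mono hqk h'
  nonempty s := by
    obtain ⟨i, a, h⟩ := hα.surj s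
    exact ⟨⟨i, a⟩, h.le⟩
  map_mem h _ ha := (hα.comp h _).trans_le ha
  le_of_mem_self h := hα.le_of_le _ _ h
  mem_of_L h := hα.mono _ h
  exists_L x := ⟨x, le_rfl, le_rfl⟩
  directed_L hx hx' _ _ := ⟨_, le_rfl, le_rfl, hx, hx'⟩
  L_trans h h' := h.trans h'
  L_map h _ _ h' := (isSystem_baseMap F).mono h h'

/-- The web of the limit functor over a direct limit is the direct limit of the webs. -/
theorem IsDirectLimit.isDirectLimit_webOf (hα : IsDirectLimit (baseMap F) α) :
    IsDirectLimit (webMap F) hα.frame.webOf where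
  toIsCompatible := GermFrame.isCompatible_webOf
  surj y := by
    obtain ⟨i, a, h⟩ := hα.surj y.base
    obtain ⟨k, _, x, _, hx⟩ := GermFrame.exists_eq_webOf (X := hα.frame) h.symm
    exact ⟨k, x, hx⟩
  le_of_le _ _ x y h := GermFrame.le_of_webOf_le (X := hα.frame) h.1 h

end DirectLimitFrame

section PoS

variable {J : Type u} [Preorder J] [IsDirectedOrder J] (F : J ⥤ PoSGp.{u})

theorem exists_colimit_PoS : ∃ c : Cocone F,
    Nonempty (IsColimit c) ∧ Nonempty (IsColimit (webPoS.mapCocone c)) := by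
  let f : ∀ i j : J, i ≤ j → (F.obj i).base →o (F.obj j).base :=
    fun i j h => (F.map (homOfLE h)).base
  have : DirectedSystem (fun i => (F.obj i).base) (f · · ·) :=
    { map_self := fun i a => (isSystem_baseMap F).id i a
      map_map := fun _ _ _ h h' a => (isSystem_baseMap F).comp h h' a }
  have hα : IsDirectLimit (baseMap F) (OrderedLimit.mk f) := OrderedLimit.isDirectLimit f
  let X := hα.frame
  let c : Cocone F :=
    { pt := ⟨PartOrd.of (OrderedLimit f), X.fib⟩
      ι :=
        { app := fun i => ⟨⟨X.α i, X.compat.mono i⟩, X.fibOf i⟩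
          naturality := fun i j g => PoSGp.hom_ext fun x => X.webOf_webMap (leOfHom g) x } }
  refine ⟨c, nonempty_isColimit (fun t => ?_) (fun Z d d' h => ?_),
    nonempty_isColimit (fun t => ?_) (fun Z d d' h => ?_)⟩
  · have hw : ∀ {i j} (h : i ≤ j) x,
        Web.map (t.ι.app j).fib (webMap F h x) = Web.map (t.ι.app i).fib x := fun h x =>
      congrArg (fun k : F.obj _ ⟶ t.pt => Web.map k.fib x) (t.w (homOfLE h))
    have hτ : IsCompatible (T := t.pt.base) (baseMap F) fun i a => (t.ι.app i).base a :=
      { mono := fun i => (t.ι.app i).base.monotone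
        comp := fun _ _ h a => congrArg Web.base (hw h ⟨a, 0⟩) }
    obtain ⟨γ, hγ, h⟩ := hα.exists_desc hτ
    obtain ⟨θ, hθ⟩ := GermFrame.exists_desc (X := X) (H := t.pt.fib)
      (τ := fun i a => (t.ι.app i).base a) (fun i => (t.ι.app i).fib) hw hγ h
    exact ⟨⟨⟨γ, hγ⟩, θ⟩, fun i => PoSGp.hom_ext fun x => hθ i x⟩
  · have hw : ∀ i x, Web.map d.fib (X.webOf i x) = Web.map d'.fib (X.webOf i x) := fun i x =>
      congrArg (fun k : F.obj i ⟶ Z => Web.map k.fib x) (h i)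
    refine PoSGp.hom_ext fun y => congrFun (GermFrame.webOf_ext (Web.map_mono _) (Web.map_mono _)
      (fun y => ?_) hw) y
    obtain ⟨i, x, rfl⟩ := hα.isDirectLimit_webOf.surj y
    exact congrArg Web.base (hw i x)
  · have hτ : IsCompatible (T := t.pt) (webMap F) fun i x => (t.ι.app i).hom x :=
      { mono := fun i => (t.ι.app i).hom.monotone
        comp := fun i _ h x => congrArg (fun k : (F ⋙ webPoS).obj i ⟶ t.pt => k.hom x)
          (t.w (homOfLE h)) }
    obtain ⟨γ, hγ, h⟩ := hα.isDirectLimit_webOf.exists_desc hτ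
    exact ⟨PartOrd.ofHom ⟨γ, hγ⟩, fun i => PartOrd.ext fun x => h i x⟩
  · refine PartOrd.ext fun y => ?_
    obtain ⟨i, x, rfl⟩ := hα.isDirectLimit_webOf.surj y
    exact congrArg (fun k : (F ⋙ webPoS).obj i ⟶ Z => k.hom x) (h i)

end PoS

/-! ### Positively ordered monoids -/

theorem PoMGp.hom_ext {X Y : PoMGp.{u}} {f g : X ⟶ Y}
    (h : ∀ x, Web.map f.fib x = Web.map g.fib x) : f = g := by
  obtain ⟨α, η⟩ := f
  obtain ⟨β, ν⟩ := g
  obtain rfl : α = β := DFunLike.ext _ _ fun s => congrArg Web.base (h ⟨s, 0⟩)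
  refine PoMGp.Hom.ext' rfl fun s => heq_of_eq ?_
  ext g
  exact eq_of_heq (Web.mk.inj (h ⟨s, g⟩)).2

/-- The functor that forgets the addition of the base space. -/
def forgetPoM : PoMGp.{u} ⥤ PoSGp.{u} where
  obj X := ⟨PartOrd.of X.base, X.fib⟩
  map f := ⟨⟨f.base, f.base.monotone'⟩, f.fib⟩

section PoM

variable {J : Type u} [Preorder J] [IsDirectedOrder J] [Nonempty J] (F : J ⥤ PoMGp.{u})

theorem exists_colimit_PoM : ∃ c : Cocone F,
    Nonempty (IsColimit c) ∧ Nonempty (IsColimit (webPoM.mapCocone c)) := by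
  let f : ∀ i j : J, i ≤ j → (F.obj i).base →+o (F.obj j).base :=
    fun i j h => (F.map (homOfLE h)).base
  have : DirectedSystem (fun i => (F.obj i).base) (f · · ·) :=
    { map_self := fun i a => (isSystem_baseMap (F ⋙ forgetPoM)).id i a
      map_map := fun _ _ _ h h' a => (isSystem_baseMap (F ⋙ forgetPoM)).comp h h' a }
  have hα : IsDirectLimit (baseMap (F ⋙ forgetPoM)) (OrderedLimit.mk f) :=
    OrderedLimit.isDirectLimit f
  let X := hα.frame
  have h0 : Subsingleton (X.fib.obj (0 : OrderedLimit f)) := by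
    obtain ⟨i⟩ := ‹Nonempty J›
    rw [← OrderedLimit.mk_zero i]
    refine GermFrame.subsingleton_fib (X := X) fun k hi => ?_
    have e : baseMap (F ⋙ forgetPoM) hi (0 : (F.obj i).base) = (0 : (F.obj k).base) :=
      map_zero (f i k hi)
    rw [e]
    exact (F.obj k).subsingleton_zero
  let c : Cocone F :=
    { pt := ⟨⟨OrderedLimit f⟩, X.fib, h0⟩
      ι :=
        { app := fun i => ⟨OrderedLimit.of f i, X.fibOf i⟩
          naturality := fun i j g => PoMGp.hom_ext fun x => X.webOf_webMap (leOfHom g) x } }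
  refine ⟨c, nonempty_isColimit (fun t => ?_) (fun Z d d' h => ?_),
    nonempty_isColimit (fun t => ?_) (fun Z d d' h => ?_)⟩
  · have hw : ∀ {i j} (h : i ≤ j) x, Web.map (t.ι.app j).fib (webMap (F ⋙ forgetPoM) h x) =
        Web.map (t.ι.app i).fib x := fun h x =>
      congrArg (fun k : F.obj _ ⟶ t.pt => Web.map k.fib x) (t.w (homOfLE h))
    have hτ : IsCompatible (T := t.pt.base) (baseMap (F ⋙ forgetPoM)) fun i a =>
        (t.ι.app i).base a :=
      { mono := fun i => (t.ι.app i).base.monotone'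
        comp := fun _ _ h a => congrArg Web.base (hw h ⟨a, 0⟩) }
    obtain ⟨γ, h⟩ := IsDirectLimit.exists_addDesc (f := f) (α := OrderedLimit.of f)
      (T := t.pt.base) (τ := fun i => (t.ι.app i).base) hα hτ
    obtain ⟨θ, hθ⟩ := GermFrame.exists_desc (X := X) (H := t.pt.fib)
      (τ := fun i a => (t.ι.app i).base a) (fun i => (t.ι.app i).fib) hw γ.monotone' h
    exact ⟨⟨γ, θ⟩, fun i => PoMGp.hom_ext fun x => hθ i x⟩
  · have hw : ∀ i x, Web.map d.fib (X.webOf i x) = Web.map d'.fib (X.webOf i x) := fun i x =>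
      congrArg (fun k : F.obj i ⟶ Z => Web.map k.fib x) (h i)
    refine PoMGp.hom_ext fun y => congrFun (GermFrame.webOf_ext (Web.map_mono _) (Web.map_mono _)
      (fun y => ?_) hw) y
    obtain ⟨i, x, rfl⟩ := hα.isDirectLimit_webOf.surj y
    exact congrArg Web.base (hw i x)
  · have hτ : IsCompatible (T := t.pt.obj) (webMap (F ⋙ forgetPoM)) fun i x =>
        (t.ι.app i).hom.hom x :=
      { mono := fun i => (t.ι.app i).hom.hom.monotone'
        comp := fun i _ h x => congrArg (fun k : (F ⋙ webPoM).obj i ⟶ t.pt => k.hom.hom x)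
          (t.w (homOfLE h)) }
    obtain ⟨γ, h⟩ := IsDirectLimit.exists_addDesc (S := fun i => Web (F.obj i).fib)
      (f := fun i j h => Web.mapHom (F.map (homOfLE h)).base (F.map (homOfLE h)).fib)
      (α := fun i => Web.mapHom (OrderedLimit.of f i) (X.fibOf i))
      (T := t.pt.obj) (τ := fun i => (t.ι.app i).hom.hom) hα.isDirectLimit_webOf hτ
    exact ⟨ObjectProperty.homMk ⟨γ⟩, fun i => ConcreteCategory.hom_ext _ _ fun x => h i x⟩
  · refine ConcreteCategory.hom_ext _ _ fun y => ?_
    obtain ⟨i, x, rfl⟩ := hα.isDirectLimit_webOf.surj y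
    exact congrArg (fun k : (F ⋙ webPoM).obj i ⟶ Z => k.hom.hom x) (h i)

end PoM

/-! ### Abstract Cuntz semigroups -/

theorem CuGp.hom_ext {X Y : CuGp.{u}} {f g : X ⟶ Y}
    (h : ∀ x, Web.map f.fib x = Web.map g.fib x) : f = g := by
  obtain ⟨α, η⟩ := f
  obtain ⟨β, ν⟩ := g
  obtain rfl : α = β := DFunLike.ext _ _ fun s => congrArg Web.base (h ⟨s, 0⟩)
  refine CuGp.Hom.ext' rfl fun s => heq_of_eq ?_
  ext g
  exact eq_of_heq (Web.mk.inj (h ⟨s, g⟩)).2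

/-- The functor that forgets the addition of the base space. -/
def forgetCu : CuGp.{u} ⥤ PoSGp.{u} where
  obj X := ⟨PartOrd.of X.base, X.fib⟩
  map f := ⟨⟨f.base, f.base.mono⟩, f.fib⟩

section Cu

variable {J : Type u} [Preorder J] [IsDirectedOrder J] (F : J ⥤ CuGp.{u})

/-- The transition maps of the base spaces as morphisms of abstract Cuntz semigroups. -/
def cuBaseMap ⦃i j : J⦄ (h : i ≤ j) : CuHom (F.obj i).base (F.obj j).base :=
  (F.map (homOfLE h)).base

/-- The transition maps of the webs as morphisms of abstract Cuntz semigroups. -/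
def cuWebMap ⦃i j : J⦄ (h : i ≤ j) : CuHom (Web (F.obj i).fib) (Web (F.obj j).fib) :=
  Web.mapCuHom (F.map (homOfLE h)).base (F.map (homOfLE h)).fib

theorem isSystem_cuBaseMap : IsSystem fun _ _ h => cuBaseMap F h :=
  isSystem_baseMap (F ⋙ forgetCu)

theorem isSystem_cuWebMap : IsSystem fun _ _ h => cuWebMap F h :=
  isSystem_webMap (F ⋙ forgetCu)

variable {F} {A : Type u} [PartialOrder A] [AddCommMonoid A]
  {α : ∀ i, CuHom (F.obj i).base A}

/-- Over a colimit of abstract Cuntz semigroups, `s` is approximated by the pairs that satisfy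
`Approx`, and locally by the elements way below. -/
def IsCuLimit.frame (hA : CuAxioms A) (hα : IsCuLimit (cuBaseMap F) α) :
    GermFrame (F ⋙ forgetCu) A where
  α i := α i
  compat := ⟨fun i => (α i).mono, hα.comp⟩
  D s := {e | Approx (cuBaseMap F) α s e.idx e.pt}
  L i a' a := WayBelow (S := (F.obj i).base) a' a
  le_of_mem h := hα.approx_le h
  mono _ _ h _ he := approx_mono h he
  directed := by
    rintro s ⟨i, a⟩ ha ⟨j, b⟩ hb
    obtain ⟨k, hi, hj, c, hc, h, h'⟩ :=
      hα.approx_directed (isSystem_cuBaseMap F) (fun i => (F.obj i).cuAxioms) hA ha hb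
    exact ⟨⟨k, c⟩, hc, ⟨hi, h⟩, ⟨hj, h'⟩⟩
  nonempty s := by
    obtain ⟨r, d, hd, -⟩ :=
      hα.exists_approx_seq (isSystem_cuBaseMap F) (fun i => (F.obj i).cuAxioms) hA s
    exact ⟨⟨r 0, d 0⟩, hd 0⟩
  map_mem h _ ha := hα.approx_map (isSystem_cuBaseMap F) h ha
  le_of_mem_self h := hα.le_of_approx (isSystem_cuBaseMap F) h
  mem_of_L h := approx_self (isSystem_cuBaseMap F) h
  exists_L {i} x := by
    obtain ⟨z, -, -, hz, -⟩ := (Web.cuAxioms (G := (F.obj i).fib) (F.obj i).cuAxioms).exists_seq x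
    exact ⟨z 0, (hz 0).le, (Web.wayBelow_iff.1 (hz 0)).1⟩
  directed_L {i x x' x''} h h' hL hL' := by
    obtain ⟨z, hz, h1, h2⟩ := (Web.cuAxioms (G := (F.obj i).fib)
      (F.obj i).cuAxioms).exists_wayBelow_ge (Web.wayBelow_iff.2 ⟨hL, h⟩)
        (Web.wayBelow_iff.2 ⟨hL', h'⟩)
    exact ⟨z, hz.le, (Web.wayBelow_iff.1 hz).1, h1, h2⟩
  L_trans h h' := h.trans_le h'
  L_map h _ _ h' := (cuBaseMap F h).wayBelow h'

variable (hA : CuAxioms A) (hα : IsCuLimit (cuBaseMap F) α)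

theorem IsCuLimit.preservesColimits_fib : PreservesColimitsOfShape ℕ (hα.frame hA).fib := by
  refine GermFrame.preservesColimits_fib ?_
  rintro z hz b hb ⟨i, a⟩ ⟨k, hi, c, h, h'⟩
  obtain ⟨d, hd, hd'⟩ := (F.obj k).cuAxioms.exists_between h
  obtain ⟨n, hn⟩ := (α k).wayBelow hd' z hz b hb h'
  exact ⟨n, k, hi, d, hd, hn⟩

variable [IsOrderedAddMonoid A] [IsBotZeroClass A]

instance : PreservesColimitsOfShape ℕ (hα.frame hA).fib := hα.preservesColimits_fib hA

/-- The maps from the webs of the stages to the web of the limit functor as morphisms of abstract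
Cuntz semigroups. -/
noncomputable def IsCuLimit.cuWebOf (i : J) : CuHom (Web (F.obj i).fib) (Web (hα.frame hA).fib) :=
  Web.mapCuHom (α i) ((hα.frame hA).fibOf i)

/-- The web of the limit functor over a colimit of abstract Cuntz semigroups is the colimit of
the webs. -/
theorem IsCuLimit.isCuLimit_cuWebOf : IsCuLimit (cuWebMap F) (hα.cuWebOf hA) where
  comp _ _ h x := GermFrame.webOf_webMap (X := hα.frame hA) h x
  dense y y' h := by
    obtain ⟨h, hyy⟩ := Web.wayBelow_iff.1 h
    obtain ⟨i, a, ha, ha'⟩ := hα.dense h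
    obtain ⟨k, hi, x, hx, hy⟩ := GermFrame.exists_le_webOf (X := hα.frame hA) ha
    have e : α k x.base = α i a := (congrArg _ hx).trans (hα.comp hi a)
    exact ⟨k, x, hy, Web.le_of_le_of_le hy hyy (e.trans_le ha')⟩
  le_of_le i j x' x y h h' := by
    obtain ⟨h, hx⟩ := Web.wayBelow_iff.1 h
    have hmem : (⟨i, x'.base⟩ : Elt (F ⋙ forgetCu)) ∈ (hα.frame hA).D (α j y.base) :=
      approx_mono h'.1 (approx_self (isSystem_cuBaseMap F) h)
    exact GermFrame.le_of_webOf_le (X := hα.frame hA) hmem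
      ((GermFrame.webOf_mono (X := hα.frame hA) i hx).trans h')

end Cu

theorem exists_colimit_Cu {J : Type u} [Preorder J] [IsDirectedOrder J] [Nonempty J]
    (F : J ⥤ CuGp.{u}) : ∃ c : Cocone F,
      Nonempty (IsColimit c) ∧ Nonempty (IsColimit (webCu.mapCocone c)) := by
  have hS : ∀ i, CuAxioms (F.obj i).base := fun i => (F.obj i).cuAxioms
  have hW : ∀ i, CuAxioms (Web (F.obj i).fib) := fun i => Web.cuAxioms (hS i)
  have hs := isSystem_cuBaseMap F
  have hs' := isSystem_cuWebMap F
  obtain ⟨A, _, _, _, _, α, hA, hα⟩ := exists_isCuLimit (cuBaseMap F) hs hS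
  let X := hα.frame hA
  have hα' := hα.isCuLimit_cuWebOf hA
  have h0 : Subsingleton (X.fib.obj (0 : A)) := by
    obtain ⟨i⟩ := ‹Nonempty J›
    rw [← map_zero (α i)]
    refine GermFrame.subsingleton_fib (X := X) fun k hi => ?_
    have e : baseMap (F ⋙ forgetCu) hi (0 : (F.obj i).base) = (0 : (F.obj k).base) :=
      map_zero (cuBaseMap F hi)
    rw [e]
    exact (F.obj k).subsingleton_zero
  let c : Cocone F :=
    { pt := { base := ⟨A⟩, cuAxioms := hA, fib := X.fib, subsingleton_zero := h0,
              preserves := hα.preservesColimits_fib hA }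
      ι :=
        { app := fun i => ⟨α i, X.fibOf i⟩
          naturality := fun i j g => CuGp.hom_ext fun x => X.webOf_webMap (leOfHom g) x } }
  refine ⟨c, nonempty_isColimit (fun t => ?_) (fun Z d d' h => ?_),
    nonempty_isColimit (fun t => ?_) (fun Z d d' h => ?_)⟩
  · have hw : ∀ {i j} (h : i ≤ j) x, Web.map (t.ι.app j).fib (webMap (F ⋙ forgetCu) h x) =
        Web.map (t.ι.app i).fib x := fun h x =>
      congrArg (fun k : F.obj _ ⟶ t.pt => Web.map k.fib x) (t.w (homOfLE h))
    obtain ⟨γ, h⟩ := hα.exists_desc (T := t.pt.base) (τ := fun i => (t.ι.app i).base) hs hS hA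
      t.pt.cuAxioms fun _ _ h a => congrArg Web.base (hw h ⟨a, 0⟩)
    obtain ⟨θ, hθ⟩ := GermFrame.exists_desc (X := X) (H := t.pt.fib)
      (τ := fun i a => (t.ι.app i).base a) (fun i => (t.ι.app i).fib) hw γ.mono h
    exact ⟨⟨γ, θ⟩, fun i => CuGp.hom_ext fun x => hθ i x⟩
  · have hw : ∀ i x, Web.map d.fib (X.webOf i x) = Web.map d'.fib (X.webOf i x) := fun i x =>
      congrArg (fun k : F.obj i ⟶ Z => Web.map k.fib x) (h i)
    have hb : d.base = d'.base := hα.hom_ext (T := Z.base) hs hS hA fun i a =>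
      congrArg (fun k : F.obj i ⟶ Z => k.base a) (h i)
    exact CuGp.hom_ext fun y => congrFun (GermFrame.webOf_ext (Web.map_mono _) (Web.map_mono _)
      (fun y => congrArg (fun k : CuHom A Z.base => k y.base) hb) hw) y
  · obtain ⟨γ, h⟩ := hα'.exists_desc (T := t.pt) (τ := fun i => (t.ι.app i).hom) hs' hW
      (Web.cuAxioms hA) t.pt.cuAxioms fun i _ h x =>
        congrArg (fun k : (F ⋙ webCu).obj i ⟶ t.pt => k.hom x) (t.w (homOfLE h))
    exact ⟨⟨γ⟩, fun i => ConcreteCategory.hom_ext _ _ fun x => h i x⟩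
  · have : d.hom = d'.hom := hα'.hom_ext (T := Z) hs' hW (Web.cuAxioms hA) fun i x =>
      congrArg (fun k : (F ⋙ webCu).obj i ⟶ Z => k.hom x) (h i)
    exact congrArg CuStar.Hom.mk this

end Webbing

theorem mainTheorem3 (J : Type u) [Preorder J] [IsDirectedOrder J] [Nonempty J] :
    (∀ F : J ⥤ Webbing.PoSGp.{u}, HasColimit F ∧ ∀ c : Cocone F, IsColimit c →
      Nonempty (IsColimit (Webbing.webPoS.mapCocone c)) ∧
      ∀ (d : Cocone (F ⋙ Webbing.webPoS)) (hd : IsColimit d),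
        (∀ x y : ToType d.pt, hd.desc (Webbing.webPoS.mapCocone c) x ≤
          hd.desc (Webbing.webPoS.mapCocone c) y ↔ x ≤ y) ∧
        Function.Surjective (hd.desc (Webbing.webPoS.mapCocone c))) ∧
    (∀ F : J ⥤ Webbing.PoMGp.{u}, HasColimit F ∧ ∀ c : Cocone F, IsColimit c →
      Nonempty (IsColimit (Webbing.webPoM.mapCocone c)) ∧
      ∀ (d : Cocone (F ⋙ Webbing.webPoM)) (hd : IsColimit d),
        (∀ x y : ToType d.pt, hd.desc (Webbing.webPoM.mapCocone c) x ≤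
          hd.desc (Webbing.webPoM.mapCocone c) y ↔ x ≤ y) ∧
        Function.Surjective (hd.desc (Webbing.webPoM.mapCocone c))) ∧
    (∀ F : J ⥤ Webbing.CuGp.{u}, HasColimit F ∧ ∀ c : Cocone F, IsColimit c →
      Nonempty (IsColimit (Webbing.webCu.mapCocone c)) ∧
      ∀ (d : Cocone (F ⋙ Webbing.webCu)) (hd : IsColimit d),
        (∀ x y : ToType d.pt, hd.desc (Webbing.webCu.mapCocone c) x ≤
          hd.desc (Webbing.webCu.mapCocone c) y ↔ x ≤ y) ∧
        Function.Surjective (hd.desc (Webbing.webCu.mapCocone c))) := by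
  refine ⟨fun F => ?_, fun F => ?_, fun F => ?_⟩
  · obtain ⟨h, h'⟩ := Webbing.exists_colimit_and_isIso (Webbing.exists_colimit_PoS F)
    refine ⟨h, fun c hc => ⟨(h' c hc).1, fun d hd => ?_⟩⟩
    have := (h' c hc).2 d hd
    exact Webbing.partOrd_embedding _
  · obtain ⟨h, h'⟩ := Webbing.exists_colimit_and_isIso (Webbing.exists_colimit_PoM F)
    refine ⟨h, fun c hc => ⟨(h' c hc).1, fun d hd => ?_⟩⟩
    have := (h' c hc).2 d hd
    exact Webbing.omStar_embedding _
  · obtain ⟨h, h'⟩ := Webbing.exists_colimit_and_isIso (Webbing.exists_colimit_Cu F)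
    refine ⟨h, fun c hc => ⟨(h' c hc).1, fun d hd => ?_⟩⟩
    have := (h' c hc).2 d hd
    exact Webbing.cuStar_embedding _
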